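/- Let $p_1,p_2$ be primes (possibly equal), $N=p_1p_2$, $s=24/\gcd(24,(p_1-1)(p_2-1))$, let $e\neq s$ be a divisor of $s$, $\delta=s/e$, and assume $N\equiv 1 \bmod \delta$ (then $\delta\in\{2,3,6\}$). Let $\alpha_0=1,0,3$ for $\delta=2,3,6$ respectively, $\zeta_{24}=\exp(2\pi i/24)$, $\phi=\zeta_{24}^{(p_1-1)(p_2-1)}$ and $\chi=\phi^{-e}$. Let $\eta$ be Dedekind's function, and for a function $f$ on the upper half-plane put $(f\circ S)(z)=f(-1/z)$. Put $$\mathfrak w(z)=\frac{\eta(z/p_1)\,\eta(z/p_2)}{\eta(z/(p_1p_2))\,\eta(z)},\qquad A_\nu(z)=\mathfrak w(z+\nu),\qquad B(z)=\frac{\eta(p_1z)\,\eta(p_2z)}{\eta(z)\,\eta(p_1p_2z)},$$ $$A'_\nu=\chi^{\alpha_0-\nu}A_\nu^e,\qquad B'=B^e .$$ When $p_1\ne p_2$, let $u,v$ be any integers with $up_1+vp_2=1$ and put $$C_{2,\nu}(z)=\phi^{\theta_2(\nu)}\,\varepsilon_2\,\frac{\eta(p_1(z+\nu))\,\eta((z+\nu)/p_2)}{\eta(z+\nu)\,\eta(p_1(z+\nu)/p_2)},\qquad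 C'_{2,\nu}=\chi^{\theta_2(\nu)-\nu}\,C_{2,\nu}^e ,$$ where $\varepsilon_2$ is the Legendre symbol $\left(\frac{p_1}{p_2}\right)$ if $p_2\ne2$ and $1$ if $p_2=2$. Here $\theta_2(0)=uv(p_2+1)+u-1$ if $p_2\neq2$ and $\theta_2(0)=(3u+2)(u-1)/2$ if $p_2=2$. For $\nu$ prime to $p_2$, $\theta_2(\nu)=\mu((p_2+1)v_2+1)+\nu$ if $p_2\ne 2$, with $1\le\mu<p_2$, $\mu\equiv-(\nu p_1)^{-1}\bmod p_2$ and $v_2=(1+p_1\mu\nu)/p_2$, and $\theta_2(\nu)=(3p_1+2)(\nu+1)/2$ if $p_2=2$. The function $C'_{1,\nu}$ is defined in the same way with $(p_1,u)$ and $(p_2,v)$ exchanged. When $p_1=p_2=p$ and $1\le\nu<p$, let $1\le\mu<p$, $\mu\equiv-1/\nu\bmod p$, $1=-\mu\nu+v'p$, and put $$C_\nu(z)=\sqrt p\,\varepsilon(\nu)\,\zeta_{24}^{\theta(\nu)}\,\frac{\eta(pz)^2}{\eta(z)\,\eta(z+\nu/p)},\qquad C'_\nu=\chi^{\mu}C_\nu^e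 ,$$ where $\varepsilon(\nu)=\left(\frac{-\nu}p\right)$ and $\theta(\nu)=p\nu(1-\mu^2)+(-3p+2+v')\mu-3+3p$ if $p$ is odd, while $\varepsilon(\nu)=1$ and $\theta(\nu)=0$ if $p=2$. Then the following hold. (i) $B'\circ S=\chi^{\alpha_0}A'_0$ and $A'_0\circ S=\chi^{\alpha_0}B'$. (ii) If $0<\nu<N$, $\gcd(\nu,p_1p_2)=1$ and $1=-\omega\nu+v_{12}\,p_1p_2$ with integers $\omega,v_{12}$, then $A'_\nu\circ S=\chi^{\alpha_0}A'_\omega$. Suppose $p_1\neq p_2$. (iii) If $0<\nu=p_1\rho<p_1p_2$ and $1=-\varpi\nu+kp_2$ with integers $\rho,\varpi,k$, then $A'_\nu\circ S=\chi^{\alpha_0}C'_{2,\varpi}$. (iv) If $1\le\nu<p_2$ and $\mu\equiv-1/(\nu p_1)\bmod p_2$, then $C'_{2,\nu}\circ S=\chi^{\alpha_0}A'_{\mu p_1}$. (v) $C'_{2,0}\circ S=\chi^{\alpha_0}C'_{1,0}$. Suppose $p_1=p_2=p$. (vi) If $\nu=\rho p$ with $1\le\rho<p$, and $1=-\varpi\rho+kp$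 with $1\le\varpi<p$ and an integer $k$, then $A'_\nu\circ S=\chi^{\alpha_0}C'_\varpi$. (vii) If $1\le\nu<p$ and $\mu\equiv-1/\nu\bmod p$, then $C'_\nu\circ S=\chi^{\alpha_0}A'_{\mu p}$. -/

import Mathlib

namespace DoubleEta

open UpperHalfPlane

noncomputable section

/-- The exponent `s = 24 / gcd (24, (p₁ - 1) (p₂ - 1))` (an exact division). -/
def s (p₁ p₂ : ℕ) : ℕ := 24 / Nat.gcd 24 ((p₁ - 1) * (p₂ - 1))

/-- `δ = s / e`, for a divisor `e` of `s`. -/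
def delta (p₁ p₂ e : ℕ) : ℕ := s p₁ p₂ / e

/-- `ζ₂₄ = exp (2 π i / 24)`. -/
def zeta24 : ℂ := Complex.exp (2 * Real.pi * Complex.I / 24)

/-- `φ = ζ₂₄ ^ ((p₁ - 1) (p₂ - 1))`. -/
def phi (p₁ p₂ : ℕ) : ℂ := zeta24 ^ ((p₁ - 1) * (p₂ - 1))

/-- `χ = φ ^ (-e)`. -/
def chi (p₁ p₂ e : ℕ) : ℂ := phi p₁ p₂ ^ (-(e : ℤ))

/-- `α₀ = 1, 0, 3` for `δ = 2, 3, 6` respectively. -/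
def alpha0 (δ : ℕ) : ℤ := if δ = 2 then 1 else if δ = 3 then 0 else 3

/-- The action of `S = (0 -1; 1 0)` on functions: `f ∘ S` is `z ↦ f (S z)`. -/
def compS (f : ℍ → ℂ) : ℍ → ℂ := fun z => f (ModularGroup.S • z)

/-- The double eta quotient `𝔴_{p₁,p₂}`. -/
def w (p₁ p₂ : ℕ) (z : ℂ) : ℂ :=
  ModularForm.eta (z / p₁) * ModularForm.eta (z / p₂) /
    (ModularForm.eta (z / (p₁ * p₂)) * ModularForm.eta z)

/-- `A_ν (z) = 𝔴_{p₁,p₂} (z + ν)`. -/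
def A (p₁ p₂ : ℕ) (ν : ℤ) (z : ℍ) : ℂ := w p₁ p₂ ((z : ℂ) + ν)

/-- The conjugate `B`. -/
def B (p₁ p₂ : ℕ) (z : ℍ) : ℂ :=
  ModularForm.eta (p₁ * (z : ℂ)) * ModularForm.eta (p₂ * (z : ℂ)) /
    (ModularForm.eta z * ModularForm.eta (p₁ * p₂ * (z : ℂ)))

/-- The representative `μ ∈ {0, …, q - 1}` of `-1 / (a ν)` modulo the prime `q`
(nonzero when `q` does not divide `a ν`). -/
def mu (q : ℕ) (a ν : ℤ) : ℤ := ((-((a * ν : ℤ) : ZMod q)⁻¹).val : ℤ)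

/-- The exponent `θ₂ (ν)`, with `p = p₁`, `q = p₂` and `u p₁ + v p₂ = 1`; exchanging
`(p₁, u)` and `(p₂, v)` gives `θ₁`. Here `μ = mu q p ν` and `v₂ = (1 + p μ ν) / q`; all
divisions are exact at the values of `ν` where `θ₂` is used. -/
def theta₂ (p q : ℕ) (u v : ℤ) (ν : ℤ) : ℤ :=
  if ν = 0 then
    if q = 2 then (3 * u + 2) * (u - 1) / 2 else u * v * (q + 1) + u - 1
  else
    if q = 2 then (3 * p + 2) * ((ν + 1) / 2)
    else mu q p ν * ((q + 1) * ((1 + p * mu q p ν * ν) / q) + 1) + ν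

/-- `ε₂`: the Legendre symbol `(p / q)` if `q ≠ 2`, and `1` if `q = 2`
(`p = p₁`, `q = p₂`). -/
def eps₂ (p q : ℕ) [Fact q.Prime] : ℤ := if q = 2 then 1 else legendreSym q p

/-- The conjugate `C_{2,ν}`, with `p = p₁`, `q = p₂` and `u p₁ + v p₂ = 1`. -/
def C₂ (p q : ℕ) [Fact q.Prime] (u v : ℤ) (ν : ℤ) (z : ℍ) : ℂ :=
  phi p q ^ theta₂ p q u v ν * eps₂ p q *
    (ModularForm.eta (p * ((z : ℂ) + ν)) * ModularForm.eta (((z : ℂ) + ν) / q) /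
      (ModularForm.eta ((z : ℂ) + ν) * ModularForm.eta (p * ((z : ℂ) + ν) / q)))

/-- The exponent `θ (ν)` of the case `p₁ = p₂ = p`, where `μ = mu p 1 ν` and
`1 = -μ ν + v p`. -/
def theta (p : ℕ) (ν : ℤ) : ℤ :=
  if p = 2 then 0
  else p * ν * (1 - mu p 1 ν ^ 2) + (-3 * p + 2 + (1 + mu p 1 ν * ν) / p) * mu p 1 ν - 3 + 3 * p

/-- `ε (ν)`: the Legendre symbol `(-ν / p)` if `p` is odd, and `1` if `p = 2`. -/
def eps (p : ℕ) [Fact p.Prime] (ν : ℤ) : ℤ := if p = 2 then 1 else legendreSym p (-ν)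

/-- The conjugate `C_ν` of the case `p₁ = p₂ = p`. -/
def C (p : ℕ) [Fact p.Prime] (ν : ℤ) (z : ℍ) : ℂ :=
  (Real.sqrt p : ℂ) * eps p ν * zeta24 ^ theta p ν *
    (ModularForm.eta (p * (z : ℂ)) ^ 2 /
      (ModularForm.eta z * ModularForm.eta ((z : ℂ) + ν / p)))

/-- `A'_ν = χ ^ (α₀ - ν) A_ν ^ e`. -/
def A' (p₁ p₂ e : ℕ) (ν : ℤ) : ℍ → ℂ := fun z =>
  chi p₁ p₂ e ^ (alpha0 (delta p₁ p₂ e) - ν) * A p₁ p₂ ν z ^ e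

/-- `B' = B ^ e`. -/
def B' (p₁ p₂ e : ℕ) : ℍ → ℂ := fun z => B p₁ p₂ z ^ e

/-- `C'_{2,ν} = χ ^ (θ₂ (ν) - ν) C_{2,ν} ^ e`. -/
def C₂' (p₁ p₂ : ℕ) [Fact p₂.Prime] (u v : ℤ) (e : ℕ) (ν : ℤ) : ℍ → ℂ := fun z =>
  chi p₁ p₂ e ^ (theta₂ p₁ p₂ u v ν - ν) * C₂ p₁ p₂ u v ν z ^ e

/-- `C'_{1,ν} = χ ^ (θ₁ (ν) - ν) C_{1,ν} ^ e`: the function `C'_{2,ν}` with the roles of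
`(p₁, u)` and `(p₂, v)` exchanged. -/
def C₁' (p₁ p₂ : ℕ) [Fact p₁.Prime] (u v : ℤ) (e : ℕ) (ν : ℤ) : ℍ → ℂ :=
  C₂' p₂ p₁ v u e ν

/-- `C'_ν = χ ^ μ C_ν ^ e`, with `μ ≡ -1 / ν` modulo `p`, for `p₁ = p₂ = p`. -/
def C' (p : ℕ) [Fact p.Prime] (e : ℕ) (ν : ℤ) : ℍ → ℂ := fun z =>
  chi p p e ^ mu p 1 ν * C p ν z ^ e

end

end DoubleEta

namespace DoubleEta
open UpperHalfPlane hiding I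
open Complex
open scoped NumberTheorySymbols

/-! At `-1/z` every η-factor of a conjugate is rewritten by the transformation law of η under
`SL₂(ℤ)`, with the multiplier explicit: a Jacobi symbol times a power of `ζ₂₄` (`etaTransformOdd`,
`eta_transform_of_odd_right`). In the quotients the square-root factors cancel, except for the `√p`
that appears in `C`. Most Jacobi symbols cancel by multiplicativity, and for the coprime shifts of
`A` and for the functions `C₂` what is left is at most one symbol and a power of `φ`.

Raising to the power `e` turns `φ ^ t` into `χ ^ (-t)`, and `χ ^ δ = 1`, so exponents matter only
modulo `δ`. The claims then reduce to `p₁ ≡ p₂ ≡ -1`, `α₀ ≡ -3` and `2 α₀ ≡ 0` modulo `δ`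
(`delta_dvd_succ`, `delta_dvd_alpha0`). Two surviving signs need care. If `δ` is even, then `e` is
odd and both primes are `3` modulo `4`, so the reciprocity sign is `-1 = χ ^ α₀`. If `δ = 3`, the
`e`-th power kills both the reciprocity sign and the symbol `(2/p)` (`eps₂_pow_swap`,
`crossSym_pow`).

For `p₁ = p₂ = p` odd, the powers of `ζ₂₄` in `C` need not be powers of `φ`, and exponents are
compared modulo `24` through `24 ∣ e (p² - 1)` (`dvd_mul_sq_sub_one`). -/

lemma zeta24_ne_zero : zeta24 ≠ 0 := exp_ne_zero _

lemma zeta24_zpow_eq_exp (n : ℤ) : zeta24 ^ n = exp (2 * Real.pi * I * n / 24) := by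
  rw [zeta24, ← exp_int_mul]
  ring_nf

lemma zeta24_pow_twentyFour : zeta24 ^ (24 : ℤ) = 1 := by
  rw [zeta24_zpow_eq_exp, ← exp_two_pi_mul_I]
  push_cast
  ring_nf

lemma zeta24_pow_twelve : zeta24 ^ (12 : ℤ) = -1 := by
  rw [zeta24_zpow_eq_exp, ← exp_pi_mul_I]
  push_cast
  ring_nf

lemma zeta24_zpow_congr {x y : ℤ} (h : (24 : ℤ) ∣ x - y) : zeta24 ^ x = zeta24 ^ y := by
  obtain ⟨k, hk⟩ := h
  rw [show x = y + 24 * k by linarith, zpow_add₀ zeta24_ne_zero, zpow_mul, zeta24_pow_twentyFour,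
    one_zpow, mul_one]

lemma neg_one_pow_eq_zeta24_zpow (n : ℕ) : (-1 : ℂ) ^ n = zeta24 ^ (12 * (n : ℤ)) := by
  rw [zpow_mul, zeta24_pow_twelve, zpow_natCast]

lemma eta_add_intCast (z : ℂ) (n : ℤ) :
    ModularForm.eta (z + n) = zeta24 ^ n * ModularForm.eta z := by
  have h1 : Function.Periodic.qParam 1 (z + n) = Function.Periodic.qParam 1 z := by
    rw [Function.Periodic.qParam, Function.Periodic.qParam]
    exact exp_eq_exp_iff_exists_int.mpr ⟨n, by push_cast; ring⟩
  have h24 : Function.Periodic.qParam 24 (z + n) =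
      zeta24 ^ n * Function.Periodic.qParam 24 z := by
    rw [zeta24_zpow_eq_exp, Function.Periodic.qParam, Function.Periodic.qParam, ← exp_add]
    push_cast
    ring_nf
  simp only [ModularForm.eta, ModularForm.eta_q, h1, h24]
  ring

/-! ### Branches of the square root, and η under `S`. -/

/-- The holomorphic square root of `z / i` on the upper half-plane with positive real part. -/
noncomputable def rootDivI (z : ℂ) : ℂ := (-I * z) ^ (1 / 2 : ℂ)

lemma neg_I_mul_ne_zero {z : ℂ} (hz : 0 < z.im) : -I * z ≠ 0 := by
  refine mul_ne_zero (by simp) ?_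
  rintro rfl
  simp at hz

lemma abs_arg_neg_I_mul_lt {z : ℂ} (hz : 0 < z.im) : |arg (-I * z)| < Real.pi / 2 :=
  abs_arg_lt_pi_div_two_iff.mpr (Or.inl (by simpa using hz))

lemma rootDivI_ne_zero {z : ℂ} (hz : 0 < z.im) : rootDivI z ≠ 0 := by
  simp [rootDivI, cpow_eq_zero_iff, neg_I_mul_ne_zero hz, -neg_mul]

lemma mul_cpow_of_arg {x y : ℂ} (hx : x ≠ 0) (hy : y ≠ 0)
    (h : arg x + arg y ∈ Set.Ioc (-Real.pi) Real.pi) (r : ℂ) :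
    (x * y) ^ r = x ^ r * y ^ r := by
  rw [cpow_def_of_ne_zero (mul_ne_zero hx hy), cpow_def_of_ne_zero hx, cpow_def_of_ne_zero hy,
    log_mul hx hy h, add_mul, exp_add]

lemma rootDivI_ofReal_mul {t : ℝ} (ht : 0 < t) (z : ℂ) :
    rootDivI (t * z) = (Real.sqrt t : ℂ) * rootDivI z := by
  rcases eq_or_ne z 0 with rfl | hz
  · simp [rootDivI]
  rw [rootDivI, rootDivI, show -I * (t * z) = t * (-I * z) by ring,
    mul_cpow_of_arg (by exact_mod_cast ht.ne') (by simpa using hz), Real.sqrt_eq_rpow,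
    ofReal_cpow ht.le]
  · simp
  · rw [arg_ofReal_of_nonneg ht.le, zero_add]
    exact arg_mem_Ioc _

lemma I_cpow_half : I ^ (1 / 2 : ℂ) = zeta24 ^ (3 : ℤ) := by
  rw [cpow_def_of_ne_zero I_ne_zero, log_I, zeta24_zpow_eq_exp]
  push_cast
  ring_nf

lemma neg_I_cpow_half : (-I) ^ (1 / 2 : ℂ) = zeta24 ^ (-3 : ℤ) := by
  rw [cpow_def_of_ne_zero (by simp), log_neg_I, zeta24_zpow_eq_exp]
  push_cast
  ring_nf

/-- Both arguments lie strictly within `π/2` of zero, so their sum stays in the range where the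
principal branch is multiplicative. The two lemmas that follow compare with `rootDivI`; they are the
source of the `± 3` in the multiplier exponents. -/
lemma rootDivI_mul_rootDivI {w z : ℂ} (hw : 0 < w.im) (hz : 0 < z.im) :
    rootDivI w * rootDivI z = (-(w * z)) ^ (1 / 2 : ℂ) := by
  have h1 := abs_lt.mp (abs_arg_neg_I_mul_lt hw)
  have h2 := abs_lt.mp (abs_arg_neg_I_mul_lt hz)
  rw [rootDivI, rootDivI, ← mul_cpow_of_arg (neg_I_mul_ne_zero hw) (neg_I_mul_ne_zero hz)
    ⟨by linarith, by linarith⟩]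
  congr 1
  linear_combination w * z * I_sq

lemma cpow_half_eq_rootDivI {u : ℂ} (hu : 0 < u.im) :
    u ^ (1 / 2 : ℂ) = zeta24 ^ (3 : ℤ) * rootDivI u := by
  have h := abs_lt.mp (abs_arg_neg_I_mul_lt hu)
  rw [← I_cpow_half, rootDivI, ← mul_cpow_of_arg I_ne_zero (neg_I_mul_ne_zero hu)]
  · congr 1
    linear_combination u * I_sq
  · rw [arg_I]
    exact ⟨by linarith, by linarith⟩

lemma neg_cpow_half_eq_rootDivI {u : ℂ} (hu : 0 < u.im) :
    (-u) ^ (1 / 2 : ℂ) = zeta24 ^ (-3 : ℤ) * rootDivI u := by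
  have h := abs_lt.mp (abs_arg_neg_I_mul_lt hu)
  rw [← neg_I_cpow_half, rootDivI, ← mul_cpow_of_arg (by simp) (neg_I_mul_ne_zero hu)]
  · congr 1
    linear_combination -u * I_sq
  · rw [arg_neg_I]
    exact ⟨by linarith, by linarith⟩

lemma eta_neg_one_div {z : ℂ} (hz : 0 < z.im) :
    ModularForm.eta (-1 / z) = rootDivI z * ModularForm.eta z := by
  have h := ModularForm.eta_comp_eq_csqrt_I_inv (show z ∈ upperHalfPlaneSet from hz)
  simp only [Function.comp, Pi.smul_apply, Pi.mul_apply, smul_eq_mul] at h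
  have hs (x : ℂ) : sqrt x = x ^ (1 / 2 : ℂ) := by simp [sqrt]
  rw [h, hs, hs, cpow_half_eq_rootDivI hz, I_cpow_half]
  field_simp [zeta24_ne_zero]

lemma im_neg_one_div_pos {z : ℂ} (hz : 0 < z.im) : 0 < (-1 / z).im := by
  have h := UpperHalfPlane.im_inv_neg_coe_pos ⟨z, hz⟩
  rwa [inv_neg, ← one_div, ← neg_div] at h

/-! ### The multiplier system of η on `SL₂(ℤ)`. -/

/-- The transformation formula of `η` under integral matrices `(a b; c d)` of determinant `1` with
`c` odd and positive. -/
def EtaTransformOdd (c : ℕ) : Prop := ∀ (a b d : ℤ) (z : ℂ), a * d - b * c = 1 → 0 < z.im →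
  ModularForm.eta ((a * z + b) / (c * z + d)) =
    J(d | c) * zeta24 ^ ((a + d) * c - b * d * (c ^ 2 - 1) - 3 * c + 3) *
      rootDivI (c * z + d) * ModularForm.eta z

lemma intCast_mul_add_im_pos {c : ℤ} (hc : 0 < c) (d : ℤ) {z : ℂ} (hz : 0 < z.im) :
    0 < (c * z + d : ℂ).im := by
  have : (0 : ℝ) < c := by exact_mod_cast hc
  simpa using mul_pos this hz

lemma intCast_mul_add_ne_zero {c : ℤ} (hc : 0 < c) (d : ℤ) {z : ℂ} (hz : 0 < z.im) :
    (c * z + d : ℂ) ≠ 0 := by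
  intro h
  have := intCast_mul_add_im_pos hc d hz
  simp [h] at this

/-- The transformation formula of `η` under integral matrices `(a b; c d)` of determinant `1` with
`c` positive and `d` odd. -/
lemma eta_transform_of_odd_right {a b c d : ℤ} (hc : 0 < c) (hd : Odd d)
    (hdet : a * d - b * c = 1) (h : EtaTransformOdd d.natAbs) {z : ℂ} (hz : 0 < z.im) :
    ModularForm.eta ((a * z + b) / (c * z + d)) =
      J(c | d.natAbs) * zeta24 ^ ((b - c) * d - a * c * (d ^ 2 - 1) + 3 * d) *
        rootDivI (c * z + d) * ModularForm.eta z := by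
  have hz0 : z ≠ 0 := by rintro rfl; simp at hz
  have hw := im_neg_one_div_pos hz
  have hu := intCast_mul_add_im_pos hc d hz
  have hu0 := intCast_mul_add_ne_zero hc d hz
  -- Composition with `±S` gives the matrix `(-b a; -d c)` or `(b -a; d -c)`. The sign is chosen to
  -- make the lower left entry `|d|`, so that the hypothesis applies at `-1/z`.
  rcases le_or_gt d 0 with hd0 | hd0
  · obtain ⟨f, hf⟩ := Int.exists_eq_neg_ofNat hd0
    obtain rfl := hf
    have hf0 : 0 < (f : ℤ) := by rcases hd with ⟨k, hk⟩; lia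
    have hv := intCast_mul_add_im_pos hf0 c hw
    have hv0 := intCast_mul_add_ne_zero hf0 c hw
    have key := h (-b) a c (-1 / z) (by push_cast; simp; linarith) hw
    simp only [Int.natAbs_neg, Int.natAbs_natCast] at key ⊢
    have hR : rootDivI (f * (-1 / z) + c) * rootDivI z =
        zeta24 ^ (-3 : ℤ) * rootDivI (c * z + (-(f : ℤ) : ℤ)) := by
      rw [← neg_cpow_half_eq_rootDivI hu,
        rootDivI_mul_rootDivI (by simpa using hv) hz]
      congr 2
      push_cast
      field_simp
      ring
    rw [eta_neg_one_div hz] at key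
    have e1 : ((-b : ℤ) * (-1 / z) + a) / (f * (-1 / z) + c) =
        (a * z + b) / (c * z + (-(f : ℤ) : ℤ)) := by
      rw [div_eq_div_iff (by simpa using hv0) hu0]
      push_cast
      field_simp
      ring
    rw [e1] at key
    rw [key]
    have e2 : (-b + c) * (f : ℤ) - a * c * ((f : ℤ) ^ 2 - 1) - 3 * f + 3 =
      ((b - c) * (-(f : ℤ)) - a * c * ((-(f : ℤ)) ^ 2 - 1) + 3 * (-(f : ℤ))) + 3 := by ring
    rw [e2, zpow_add₀ zeta24_ne_zero]
    rw [zpow_neg] at hR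
    have h3 : zeta24 ^ (3 : ℤ) ≠ 0 := zpow_ne_zero _ zeta24_ne_zero
    rw [eq_inv_mul_iff_mul_eq₀ h3] at hR
    rw [← hR]
    ring
  · obtain ⟨f, rfl⟩ := Int.eq_ofNat_of_zero_le hd0.le
    have hv := intCast_mul_add_im_pos hd0 (-c) hw
    have hv0 := intCast_mul_add_ne_zero hd0 (-c) hw
    have key := h b (-a) (-c) (-1 / z) (by simp; linarith) hw
    simp only [Int.natAbs_natCast] at key ⊢
    have hR : rootDivI (f * (-1 / z) + (-c : ℤ)) * rootDivI z =
        zeta24 ^ (3 : ℤ) * rootDivI (c * z + (f : ℤ)) := by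
      rw [← cpow_half_eq_rootDivI hu,
        rootDivI_mul_rootDivI (by simpa using hv) hz]
      congr 1
      push_cast
      field_simp
      ring
    rw [eta_neg_one_div hz] at key
    have e1 : (b * (-1 / z) + (-a : ℤ)) / (f * (-1 / z) + (-c : ℤ)) =
        (a * z + b) / (c * z + (f : ℤ)) := by
      rw [div_eq_div_iff (by simpa using hv0) hu0]
      push_cast
      field_simp
      ring
    rw [e1] at key
    obtain ⟨n, hn⟩ : Odd f := by exact_mod_cast hd
    -- Replacing `-c` by `c` in the symbol costs `(-1) ^ n = ζ₂₄ ^ (12 n)`. With `f = 2n + 1` this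
    -- accounts for the passage from `-3f + 3` to `3f`, up to the `3` supplied by the square root.
    have hJ := jacobiSym.neg c (b := f) ⟨n, hn⟩
    rw [ZMod.χ₄_eq_neg_one_pow (by lia), show f / 2 = n by lia] at hJ
    rw [key, hJ]
    have e2 : (b - c) * f - a * c * ((f : ℤ) ^ 2 - 1) + 3 * f = 12 * (n : ℤ) +
        ((b + -c) * (f : ℤ) - -a * -c * ((f : ℤ) ^ 2 - 1) - 3 * f + 3) + 3 := by
      rw [hn]; push_cast; ring
    rw [e2]
    generalize (b + -c) * (f : ℤ) - -a * -c * ((f : ℤ) ^ 2 - 1) - 3 * f + 3 = X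
    rw [zpow_add₀ zeta24_ne_zero _ 3, zpow_add₀ zeta24_ne_zero, ← neg_one_pow_eq_zeta24_zpow]
    push_cast at hR ⊢
    linear_combination (J(c | f) * (-1) ^ n * zeta24 ^ X * ModularForm.eta z) * hR

lemma dvd_mul_sq_sub_one_of_odd {c : ℤ} (hc : Odd c) : 24 ∣ c * (c ^ 2 - 1) := by
  obtain ⟨m, rfl⟩ := hc
  have h : (2 * m + 1) * ((2 * m + 1) ^ 2 - 1) = 4 * (m * (m + 1) * (2 * m + 1)) := by ring
  have h6 : (6 : ℤ) ∣ m * (m + 1) * (2 * m + 1) := by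
    apply (ZMod.intCast_zmod_eq_zero_iff_dvd _ 6).mp
    push_cast
    generalize (m : ZMod 6) = x
    decide +revert
  rw [h]
  exact mul_dvd_mul_left 4 h6

/-- For odd `c` and `d` the two forms of the multiplier system of `η` agree. -/
lemma jacobiSym_mul_zeta24_zpow_eq {a b d : ℤ} {c : ℕ} (hc : Odd c) (hd : Odd d)
    (hdet : a * d - b * c = 1) :
    (J((c : ℤ) | d.natAbs) : ℂ) * zeta24 ^ ((b - c) * d - a * c * (d ^ 2 - 1) + 3 * d) =
      J(d | c) * zeta24 ^ ((a + d) * c - b * d * ((c : ℤ) ^ 2 - 1) - 3 * c + 3) := by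
  obtain ⟨m, hm⟩ := hc
  have hnat : Odd d.natAbs := by simpa using hd
  obtain ⟨n, hn⟩ := hnat
  have hrec := jacobiSym.quadratic_reciprocity (a := c) (b := d.natAbs) ⟨m, hm⟩ ⟨n, hn⟩
  rw [show c / 2 = m by lia, show d.natAbs / 2 = n by lia] at hrec
  rcases Int.natAbs_eq d with h | h
  · rw [← h] at hrec
    rw [hrec]
    push_cast
    rw [neg_one_pow_eq_zeta24_zpow, mul_right_comm, mul_comm, ← zpow_add₀ zeta24_ne_zero]
    congr 1
    apply zeta24_zpow_congr
    have hd' : d = 2 * n + 1 := by lia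
    subst hm
    refine ⟨0, ?_⟩
    push_cast at hdet ⊢
    rw [hd'] at hdet ⊢
    linear_combination (-(2 * m + 1 : ℤ) * (2 * n + 1)) * hdet
  -- For negative `d` the symbol of `-1` modulo `c` adds the sign `(-1) ^ m` to the reciprocity
  -- sign.
  · have hJ := jacobiSym.neg (d.natAbs : ℤ) (b := c) ⟨m, hm⟩
    rw [ZMod.χ₄_eq_neg_one_pow (by lia), show c / 2 = m by lia, ← h] at hJ
    rw [hrec, hJ]
    generalize J((d.natAbs : ℤ) | c) = j
    have hd' : d = -(2 * n + 1) := by lia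
    have hexp : zeta24 ^ (12 * ((m * n : ℕ) : ℤ)) *
        zeta24 ^ ((b - c) * d - a * c * (d ^ 2 - 1) + 3 * d) = zeta24 ^ (12 * (m : ℤ)) *
        zeta24 ^ ((a + d) * c - b * d * ((c : ℤ) ^ 2 - 1) - 3 * c + 3) := by
      rw [← zpow_add₀ zeta24_ne_zero, ← zpow_add₀ zeta24_ne_zero]
      apply zeta24_zpow_congr
      subst hm
      refine ⟨m * n, ?_⟩
      push_cast at hdet ⊢
      rw [hd'] at hdet ⊢
      linear_combination ((2 * m + 1 : ℤ) * (2 * n + 1)) * hdet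
    push_cast
    rw [neg_one_pow_eq_zeta24_zpow, neg_one_pow_eq_zeta24_zpow]
    linear_combination (j : ℂ) * hexp

/-- With lower left entry `1` the matrix acts as `z ↦ a - 1/(z + d)`: a translation, then `S`, then
a translation. -/
lemma etaTransformOdd_one : EtaTransformOdd 1 := by
  intro a b d z hdet hz
  have hzd : 0 < (z + d).im := by simpa
  have hzd0 : z + d ≠ 0 := by intro h; simp [h] at hzd
  have e : (a * z + b) / ((1 : ℕ) * z + d) = -1 / (z + d) + (a : ℤ) := by
    have hb : (b : ℂ) = a * d - 1 := by
      have : b = a * d - 1 := by push_cast at hdet; linarith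
      exact_mod_cast this
    rw [hb]
    push_cast
    field_simp
    ring
  rw [e, eta_add_intCast, eta_neg_one_div hzd, eta_add_intCast]
  have : (a + d) * ((1 : ℕ) : ℤ) - b * d * (((1 : ℕ) : ℤ) ^ 2 - 1) - 3 * ((1 : ℕ) : ℤ) + 3 =
    a + d := by push_cast; ring
  rw [this, zpow_add₀ zeta24_ne_zero]
  simp
  ring

/-- Euclidean descent on the lower row: a translation reduces `d` modulo `c`, and `S` exchanges the
roles of `c` and `d`. Quadratic reciprocity makes the two forms of the multiplier match, so the
induction closes. -/
theorem etaTransformOdd (c : ℕ) (hc : Odd c) : EtaTransformOdd c := by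
  induction c using Nat.strong_induction_on with
  | _ c ih =>
    rcases eq_or_ne c 1 with rfl | hc1
    · exact etaTransformOdd_one
    intro a b d z hdet hz
    -- As `c` is odd, `d % c` and `d % c - c` have opposite parity, so one of them is odd. The
    -- determinant excludes `d % c = 0`, which keeps both below `c` in absolute value.
    obtain ⟨t, ht, hlt⟩ : ∃ t : ℤ, Odd (d - t * c) ∧ (d - t * c).natAbs < c := by
      have h1 := Int.emod_add_mul_ediv d c
      have h2 := Int.emod_nonneg d (b := c) (by have := hc.pos; lia)
      have h3 := Int.emod_lt_of_pos d (b := c) (by have := hc.pos; lia)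
      have h4 : d % c ≠ 0 := by
        intro h0
        have hdvd : (c : ℤ) ∣ 1 := by
          rw [← hdet]
          exact dvd_sub ((Int.dvd_of_emod_eq_zero h0).mul_left _) (dvd_mul_left _ _)
        exact hc1 (by simpa using Int.natAbs_dvd_natAbs.mpr hdvd)
      obtain ⟨m, hm⟩ := hc
      rcases Int.even_or_odd (d % c) with h | h
      · refine ⟨d / c + 1, ?_, ?_⟩
        · rw [show d - (d / c + 1) * c = d % c - c by linarith]
          obtain ⟨k, hk⟩ := h
          exact ⟨k - m - 1, by lia⟩
        · rw [show d - (d / c + 1) * c = d % c - c by linarith]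
          lia
      · refine ⟨d / c, ?_, ?_⟩
        · rwa [show d - d / c * c = d % c by linarith]
        · rw [show d - d / c * c = d % c by linarith]
          lia
    have hzt : 0 < (z + t).im := by simpa
    have hdet' : a * (d - t * c) - (b - a * t) * c = 1 := by linarith
    have key := eta_transform_of_odd_right (c := c) (by have := hc.pos; lia) ht hdet'
      (ih _ hlt (by simpa using ht)) hzt
    rw [jacobiSym_mul_zeta24_zpow_eq hc ht hdet', eta_add_intCast] at key
    have e1 : (a * (z + t) + (b - a * t : ℤ)) / (((c : ℤ) : ℂ) * (z + t) + (d - t * c : ℤ)) =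
        (a * z + b) / (c * z + d) := by
      push_cast
      congr 1 <;> ring
    have e2 : ((c : ℤ) : ℂ) * (z + t) + (d - t * c : ℤ) = c * z + d := by
      push_cast
      ring
    have hJ : J(d - t * c | c) = J(d | c) := jacobiSym.mod_left' (by simp)
    rw [e1, e2, hJ] at key
    rw [key]
    -- Given the determinant relation, the two exponents differ by a multiple of `c (c² - 1)`, which
    -- `24` divides.
    have e3 : zeta24 ^ ((a + d) * c - b * d * ((c : ℤ) ^ 2 - 1) - 3 * c + 3) =
        zeta24 ^ ((a + (d - t * c)) * c - (b - a * t) * (d - t * c) * ((c : ℤ) ^ 2 - 1) - 3 * c + 3)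
          * zeta24 ^ t := by
      rw [← zpow_add₀ zeta24_ne_zero]
      apply zeta24_zpow_congr
      obtain ⟨k, hk⟩ := dvd_mul_sq_sub_one_of_odd (c := c) (by simpa using hc)
      refine ⟨-k * t * (2 * b - a * t), ?_⟩
      linear_combination (-t * (2 * b - a * t)) * hk - t * ((c : ℤ) ^ 2 - 1) * hdet
    rw [e3]
    ring

/-! ### Multipliers in the form used for the quotients. -/

/-- The multiplier of `eta_div_mul_of_odd`. -/
noncomputable def multOdd (q : ℕ) (a k h : ℤ) : ℂ :=
  J(-h | q) * zeta24 ^ ((a - h) * q - k * h * ((q : ℤ) ^ 2 - 1) - 3 * q + 3)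

/-- The multiplier of `eta_div_mul_of_odd_right`. -/
noncomputable def multRight (q : ℕ) (a k h : ℤ) : ℂ :=
  J((q : ℤ) | h.natAbs) * zeta24 ^ ((k + q) * h - a * q * (h ^ 2 - 1) - 3 * h)

/-- The matrix `(a -k; q -h)` sends `(z + h)/q` to `(a z - 1)/(q z)`, and its automorphy factor
there is just `z`. The root factor is thus independent of `q` and `h`, which is why it cancels in
quotients. -/
lemma eta_div_mul_of_odd {q : ℕ} (hq : Odd q) {a k h : ℤ} (hdet : 1 = -h * a + k * q) {z : ℂ}
    (hz : 0 < z.im) : ModularForm.eta ((a * z - 1) / (q * z)) =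
      multOdd q a k h * rootDivI z * ModularForm.eta ((z + h) / q) := by
  have hq0 : (q : ℂ) ≠ 0 := by exact_mod_cast hq.pos.ne'
  have hz0 : z ≠ 0 := by rintro rfl; simp at hz
  have hqR : (0 : ℝ) < q := by exact_mod_cast hq.pos
  have hw : 0 < ((z + h) / q).im := by
    rw [div_natCast_im]
    simpa using div_pos hz hqR
  have key := etaTransformOdd q hq a (-k) (-h) ((z + h) / q) (by linarith) hw
  have hdet' : (1 : ℂ) = -h * a + k * q := by exact_mod_cast hdet
  have e1 : (q : ℂ) * ((z + h) / q) + (-h : ℤ) = z := by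
    push_cast; field_simp; ring
  have e2 : (a * ((z + h) / q) + (-k : ℤ)) / z = (a * z - 1) / (q * z) := by
    push_cast; field_simp; linear_combination hdet'
  rw [e1, e2] at key
  rw [key, multOdd]
  congr 4
  ring

lemma eta_div_mul_of_odd_right {q : ℕ} (hq : 0 < q) {a k h : ℤ} (hh : Odd h)
    (hdet : 1 = -h * a + k * q) {z : ℂ}
    (hz : 0 < z.im) : ModularForm.eta ((a * z - 1) / (q * z)) =
      multRight q a k h * rootDivI z * ModularForm.eta ((z + h) / q) := by
  have hq0 : (q : ℂ) ≠ 0 := by exact_mod_cast hq.ne'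
  have hz0 : z ≠ 0 := by rintro rfl; simp at hz
  have hqR : (0 : ℝ) < q := by exact_mod_cast hq
  have hw : 0 < ((z + h) / q).im := by
    rw [div_natCast_im]
    simpa using div_pos hz hqR
  have key := eta_transform_of_odd_right (a := a) (b := -k) (c := q) (d := -h) (by exact_mod_cast hq)
    hh.neg (by linarith) (etaTransformOdd _ (by simpa using hh)) hw
  have hdet' : (1 : ℂ) = -h * a + k * q := by exact_mod_cast hdet
  have e1 : ((q : ℤ) : ℂ) * ((z + h) / q) + (-h : ℤ) = z := by
    push_cast; field_simp; ring
  have e2 : (a * ((z + h) / q) + (-k : ℤ)) / z = (a * z - 1) / (q * z) := by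
    push_cast; field_simp; linear_combination hdet'
  rw [e1, e2] at key
  rw [key, multRight, Int.natAbs_neg]
  congr 4
  ring

lemma quotient_of_multipliers {m m₁ m₂ m₃ m₄ r₁ r₂ r₃ r₄ x₁ x₂ x₃ x₄ : ℂ}
    (hm : m₁ * m₂ = m * (m₃ * m₄)) (hr : r₁ * r₂ = r₃ * r₄) (hm0 : m₃ * m₄ ≠ 0)
    (hr0 : r₃ * r₄ ≠ 0) :
    (m₁ * r₁ * x₁) * (m₂ * r₂ * x₂) / ((m₃ * r₃ * x₃) * (m₄ * r₄ * x₄)) =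
      m * (x₁ * x₂ / (x₃ * x₄)) := by
  rw [show (m₁ * r₁ * x₁) * (m₂ * r₂ * x₂) = (m₁ * m₂) * (r₁ * r₂) * (x₁ * x₂) by ring,
    show (m₃ * r₃ * x₃) * (m₄ * r₄ * x₄) = (m₃ * m₄) * (r₃ * r₄) * (x₃ * x₄) by ring, hm, hr,
    show m * (m₃ * m₄) * (r₃ * r₄) = m * ((m₃ * m₄) * (r₃ * r₄)) by ring, mul_div_mul_comm,
    mul_div_cancel_right₀ _ (mul_ne_zero hm0 hr0)]

/-! ### Arithmetic of `s`, `δ` and `χ`. -/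

section Arithmetic

variable {p q e : ℕ}

lemma s_mul_gcd (p q : ℕ) : s p q * Nat.gcd 24 ((p - 1) * (q - 1)) = 24 :=
  Nat.div_mul_cancel (Nat.gcd_dvd_left _ _)

lemma delta_mul (h : e ∣ s p q) : delta p q e * e = s p q := Nat.div_mul_cancel h

lemma s_dvd (p q : ℕ) : s p q ∣ 24 := ⟨_, (s_mul_gcd p q).symm⟩

lemma s_pos (p q : ℕ) : 0 < s p q := Nat.pos_of_dvd_of_pos (s_dvd p q) (by norm_num)

lemma dvd_delta_mul (h : e ∣ s p q) : 24 ∣ delta p q e * e * ((p - 1) * (q - 1)) := by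
  rw [delta_mul h]
  obtain ⟨k, hk⟩ := Nat.gcd_dvd_right 24 ((p - 1) * (q - 1))
  exact ⟨k, by rw [← s_mul_gcd p q, mul_assoc, ← hk]⟩

lemma cast_pred_mul_pred (hp : 0 < p) (hq : 0 < q) :
    (((p - 1) * (q - 1) : ℕ) : ℤ) = (p - 1) * (q - 1) := by
  rw [Nat.cast_mul, Nat.cast_pred hp, Nat.cast_pred hq]

lemma phi_zpow (hp : 0 < p) (hq : 0 < q) (n : ℤ) :
    phi p q ^ n = zeta24 ^ (((p : ℤ) - 1) * (q - 1) * n) := by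
  rw [phi, ← zpow_natCast, ← zpow_mul, cast_pred_mul_pred hp hq]

lemma phi_ne_zero (p q : ℕ) : phi p q ≠ 0 := pow_ne_zero _ zeta24_ne_zero

lemma chi_ne_zero (p q e : ℕ) : chi p q e ≠ 0 := zpow_ne_zero _ (phi_ne_zero p q)

lemma chi_zpow (hp : 0 < p) (hq : 0 < q) (n : ℤ) :
    chi p q e ^ n = zeta24 ^ (-(e * (((p : ℤ) - 1) * (q - 1)) * n)) := by
  rw [chi, ← zpow_mul, phi_zpow hp hq]
  congr 1
  ring

lemma phi_zpow_pow (p q e : ℕ) (n : ℤ) : (phi p q ^ n) ^ e = chi p q e ^ (-n) := by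
  rw [chi, ← zpow_mul, ← zpow_natCast, ← zpow_mul]
  congr 1
  ring

lemma delta_comm (p q e : ℕ) : delta p q e = delta q p e := by
  rw [delta, delta, s, s, mul_comm]

lemma chi_zpow_congr (hp : 0 < p) (hq : 0 < q) (h : e ∣ s p q) {x y : ℤ}
    (hxy : (delta p q e : ℤ) ∣ x - y) : chi p q e ^ x = chi p q e ^ y := by
  rw [chi_zpow hp hq, chi_zpow hp hq]
  apply zeta24_zpow_congr
  obtain ⟨k, hk⟩ := hxy
  obtain ⟨l, hl⟩ := dvd_delta_mul h
  have hl' : (delta p q e : ℤ) * e * ((p - 1) * (q - 1)) = 24 * l := by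
    rw [← cast_pred_mul_pred hp hq]
    exact_mod_cast hl
  refine ⟨-(k * l), ?_⟩
  linear_combination (-(e * (((p : ℤ) - 1) * (q - 1)))) * hk - k * hl'

lemma odd_mul_of_two_dvd_delta (hN : p * q ≡ 1 [MOD delta p q e]) (h2 : 2 ∣ delta p q e) :
    Odd p ∧ Odd q := by
  have := hN.of_dvd h2
  rw [← Nat.odd_mul]
  exact Nat.odd_iff.mpr this

/-- An even `δ` makes both `p` and `q` odd, so `4 ∣ (p - 1)(q - 1)` and `s ∣ 6`. As `s` is even but
not divisible by `4`, neither `e` nor `(p - 1)(q - 1)/4` can be even. -/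
lemma even_delta (h : e ∣ s p q) (hN : p * q ≡ 1 [MOD delta p q e])
    (h2 : 2 ∣ delta p q e) : p % 4 = 3 ∧ q % 4 = 3 ∧ Odd e ∧ s p q ∣ 6 := by
  have hs := s_mul_gcd p q
  have hd := delta_mul h
  obtain ⟨hpo, hqo⟩ := odd_mul_of_two_dvd_delta hN h2
  obtain ⟨m, hm⟩ := hpo
  obtain ⟨n, hn⟩ := hqo
  have hg : (p - 1) * (q - 1) = 4 * (m * n) := by
    rw [hm, hn, Nat.add_sub_cancel, Nat.add_sub_cancel]
    ring
  rw [hg] at hs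
  have h4 : 4 ∣ Nat.gcd 24 (4 * (m * n)) := Nat.dvd_gcd (by norm_num) (dvd_mul_right _ _)
  obtain ⟨k, hk⟩ := h4
  rw [hk] at hs
  have hsk : s p q * k = 6 := by lia
  have hs6 : s p q ∣ 6 := ⟨k, hsk.symm⟩
  have hs2 : 2 ∣ s p q := h2.trans ⟨e, hd.symm⟩
  have heo : Odd e := by
    rw [← Nat.not_even_iff_odd]
    intro he
    have h4s : 4 ∣ s p q := by
      rw [← hd]
      exact mul_dvd_mul h2 he.two_dvd
    exact absurd (h4s.trans hs6) (by norm_num)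
  have hmn : Odd (m * n) := by
    rw [← Nat.not_even_iff_odd]
    intro he
    have h8 : 8 ∣ Nat.gcd 24 (4 * (m * n)) :=
      Nat.dvd_gcd (by norm_num) (mul_dvd_mul_left 4 he.two_dvd)
    rw [hk] at h8
    have h2k : 2 ∣ k := by lia
    have : 4 ∣ s p q * k := mul_dvd_mul hs2 h2k
    rw [hsk] at this
    exact absurd this (by norm_num)
  obtain ⟨hmo, hno⟩ := Nat.odd_mul.mp hmn
  rw [Nat.odd_iff] at hmo hno
  exact ⟨by lia, by lia, heo, hs6⟩

lemma delta_cases (h : e ∣ s p q) (hne : e ≠ s p q)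
    (hN : p * q ≡ 1 [MOD delta p q e]) :
    delta p q e = 2 ∨ delta p q e = 3 ∨ delta p q e = 6 := by
  have hd := delta_mul h
  have h1 : delta p q e ≠ 1 := by
    intro h1
    rw [h1, one_mul] at hd
    exact hne hd
  have hds : delta p q e ∣ s p q := ⟨e, hd.symm⟩
  have h0 : delta p q e ≠ 0 := by
    intro h0
    rw [h0, zero_mul] at hd
    exact (s_pos p q).ne hd
  by_cases h2 : 2 ∣ delta p q e
  · have h6 := hds.trans (even_delta h hN h2).2.2.2
    have := Nat.le_of_dvd (by norm_num) h6
    interval_cases delta p q e <;> simp_all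
  · have h24 := hds.trans (s_dvd p q)
    have := Nat.le_of_dvd (by norm_num) h24
    interval_cases delta p q e <;> simp_all

/-- Since `9 ∤ 24`, a factor `3` in `s` excludes one in `(p - 1)(q - 1)`. Neither prime is then `1`
modulo `3`, and their product is. -/
lemma mod_three_of_three_dvd_delta (h : e ∣ s p q)
    (hN : p * q ≡ 1 [MOD delta p q e]) (h3 : 3 ∣ delta p q e) : p % 3 = 2 ∧ q % 3 = 2 := by
  have hs := s_mul_gcd p q
  have h3s : 3 ∣ s p q := h3.trans ⟨e, (delta_mul h).symm⟩
  have hg : ¬ 3 ∣ (p - 1) * (q - 1) := by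
    intro hg
    have := mul_dvd_mul h3s (Nat.dvd_gcd (by norm_num : 3 ∣ 24) hg)
    rw [hs] at this
    exact absurd this (by norm_num)
  have hN3 : p * q % 3 = 1 := hN.of_dvd h3
  rw [Nat.prime_three.dvd_mul, not_or] at hg
  rw [Nat.mul_mod] at hN3
  have h1 : p % 3 < 3 := Nat.mod_lt _ (by norm_num)
  have h2 : q % 3 < 3 := Nat.mod_lt _ (by norm_num)
  have h1' : p % 3 ≠ 1 := by lia
  have h2' : q % 3 ≠ 1 := by lia
  generalize p % 3 = x at *
  generalize q % 3 = y at *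
  interval_cases x <;> interval_cases y <;> simp_all

lemma delta_dvd_succ (h : e ∣ s p q) (hne : e ≠ s p q)
    (hN : p * q ≡ 1 [MOD delta p q e]) :
    (delta p q e : ℤ) ∣ p + 1 ∧ (delta p q e : ℤ) ∣ q + 1 := by
  have h2 := even_delta h hN
  have h3 := mod_three_of_three_dvd_delta h hN
  rcases delta_cases h hne hN with hd | hd | hd <;> rw [hd] at h2 h3 ⊢
  · have := h2 (by norm_num)
    lia
  · have := h3 (by norm_num)
    lia
  · have := h2 (by norm_num)
    have := h3 (by norm_num)
    lia

/-- The congruence `α₀ ≡ -3` absorbs the constant `3` in `multOdd_coprime`; `2 α₀ ≡ 0` gives `χ ^ (2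
α₀) = 1`, consistent with `S` being an involution. -/
lemma delta_dvd_alpha0 (h : e ∣ s p q) (hne : e ≠ s p q)
    (hN : p * q ≡ 1 [MOD delta p q e]) :
    (delta p q e : ℤ) ∣ 2 * alpha0 (delta p q e) ∧
      (delta p q e : ℤ) ∣ alpha0 (delta p q e) + 3 := by
  rcases delta_cases h hne hN with hd | hd | hd <;> rw [hd] <;> norm_num [alpha0]

/-- Here `δ = 2 α₀` with `α₀` odd. Writing `δ e (p - 1)(q - 1) = 24 l` gives `χ ^ α₀ = ζ₂₄ ^ (-12
l)`, and dividing by `8` shows that `3 l` is a product of odd numbers. -/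
lemma chi_zpow_alpha0_of_even (hp : 0 < p) (hq : 0 < q) (h : e ∣ s p q) (hne : e ≠ s p q)
    (hN : p * q ≡ 1 [MOD delta p q e]) (h2 : 2 ∣ delta p q e) :
    chi p q e ^ alpha0 (delta p q e) = -1 := by
  obtain ⟨hp4, hq4, heo, hs6⟩ := even_delta h hN h2
  rw [chi_zpow hp hq, ← zeta24_pow_twelve]
  apply zeta24_zpow_congr
  have h24 := dvd_delta_mul h
  have h24' : (24 : ℤ) ∣ delta p q e * e * ((p - 1) * (q - 1)) := by
    rw [← cast_pred_mul_pred hp hq]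
    exact_mod_cast h24
  have ha : (delta p q e : ℤ) = 2 * alpha0 (delta p q e) ∧ Odd (alpha0 (delta p q e)) := by
    rcases delta_cases h hne hN with hd | hd | hd <;> rw [hd] at h2 ⊢
    · simp [alpha0]
    · simp at h2
    · simp only [alpha0]
      exact ⟨by norm_num, by decide⟩
  obtain ⟨ha2, i, hi⟩ := ha
  rw [ha2] at h24'
  obtain ⟨j, hj⟩ := heo
  obtain ⟨l, hl⟩ := h24'
  obtain ⟨m, hm⟩ : ∃ m : ℤ, (p : ℤ) - 1 = 4 * m + 2 := ⟨p / 4, by lia⟩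
  obtain ⟨n, hn⟩ : ∃ n : ℤ, (q : ℤ) - 1 = 4 * n + 2 := ⟨q / 4, by lia⟩
  have hj' : (e : ℤ) = 2 * j + 1 := by exact_mod_cast hj
  have hlo : Odd l := by
    have hodd : Odd ((2 * i + 1) * (2 * (j : ℤ) + 1) * ((2 * m + 1) * (2 * n + 1))) :=
      ((odd_two_mul_add_one i).mul (odd_two_mul_add_one _)).mul
        ((odd_two_mul_add_one m).mul (odd_two_mul_add_one n))
    have e3 : (2 * i + 1) * (2 * (j : ℤ) + 1) * ((2 * m + 1) * (2 * n + 1)) = 3 * l := by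
      rw [hi, hj', hm, hn] at hl
      linarith
    rw [e3] at hodd
    exact (Int.odd_mul.mp hodd).2
  obtain ⟨t, ht⟩ := hlo
  refine ⟨-(t + 1), ?_⟩
  rw [ht] at hl
  linarith

/-- For `δ = 3` either alternative disposes of signs: an even `e` squares them away, and `8 ∣ (p -
1)(q - 1)` makes the relevant symbols trivial. -/
lemma even_or_eight_dvd (h : e ∣ s p q) (hd : delta p q e = 3) :
    Even e ∨ 8 ∣ (p - 1) * (q - 1) := by
  rcases Nat.even_or_odd e with he | he
  · exact Or.inl he
  · right
    have h24 := dvd_delta_mul h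
    rw [hd] at h24
    have h8 : 8 ∣ 3 * e * ((p - 1) * (q - 1)) := (by norm_num : 8 ∣ 24).trans h24
    refine Nat.Coprime.dvd_of_dvd_mul_left ?_ h8
    refine Nat.Coprime.mul_right (by norm_num) ?_
    rw [show 8 = 2 ^ 3 by norm_num]
    exact Nat.Coprime.pow_left _ (Nat.coprime_two_left.mpr he)

end Arithmetic

/-! ### The η-quotients at `-1/z`. -/

lemma coe_S_smul (z : ℍ) : ((ModularGroup.S • z : ℍ) : ℂ) = -1 / z := by
  rw [UpperHalfPlane.modular_S_smul, UpperHalfPlane.coe_mk, inv_neg, neg_div, one_div]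

lemma natCast_mul_im_pos {n : ℕ} (hn : 0 < n) {z : ℂ} (hz : 0 < z.im) : 0 < (n * z : ℂ).im := by
  have : (0 : ℝ) < n := by exact_mod_cast hn
  simpa using mul_pos this hz

lemma div_natCast_im_pos {n : ℕ} (hn : 0 < n) {z : ℂ} (hz : 0 < z.im) : 0 < (z / n : ℂ).im := by
  have : (0 : ℝ) < n := by exact_mod_cast hn
  rw [div_natCast_im]
  exact div_pos hz this

lemma ne_zero_of_im_pos {z : ℂ} (hz : 0 < z.im) : z ≠ 0 := by
  rintro rfl
  simp at hz

lemma rootDivI_natCast_mul {n : ℕ} (hn : 0 < n) (z : ℂ) :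
    rootDivI (n * z) = (Real.sqrt n : ℂ) * rootDivI z := by
  rw [← rootDivI_ofReal_mul (by exact_mod_cast hn)]
  simp

lemma sqrt_mul_rootDivI_div {n : ℕ} (hn : 0 < n) (z : ℂ) :
    (Real.sqrt n : ℂ) * rootDivI (z / n) = rootDivI z := by
  have : (n : ℂ) ≠ 0 := by exact_mod_cast hn.ne'
  rw [← rootDivI_natCast_mul hn]
  congr 1
  field_simp

lemma sqrt_natCast_ne_zero {n : ℕ} (hn : 0 < n) : (Real.sqrt n : ℂ) ≠ 0 := by
  rw [ofReal_ne_zero]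
  exact Real.sqrt_ne_zero'.mpr (by exact_mod_cast hn)

lemma eta_add_neg_one_div {z : ℂ} (hz : 0 < z.im) (a h : ℤ) :
    ModularForm.eta (-1 / z + a) =
      zeta24 ^ (a - h) * rootDivI z * ModularForm.eta (z + h) := by
  rw [eta_add_intCast, eta_neg_one_div hz, eta_add_intCast, zpow_sub₀ zeta24_ne_zero]
  field_simp [zpow_ne_zero h zeta24_ne_zero]

/-- The eta quotient defining `B`. -/
noncomputable def wConj (p q : ℕ) (x : ℂ) : ℂ :=
  ModularForm.eta (p * x) * ModularForm.eta (q * x) /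
    (ModularForm.eta x * ModularForm.eta (p * q * x))

/-- The eta quotient defining `C₂`. -/
noncomputable def c₂Quot (p q : ℕ) (x : ℂ) : ℂ :=
  ModularForm.eta (p * x) * ModularForm.eta (x / q) /
    (ModularForm.eta x * ModularForm.eta (p * x / q))

section Transformations

variable {p q : ℕ} {z : ℂ}

lemma wConj_neg_one_div (hp : 0 < p) (hq : 0 < q) (hz : 0 < z.im) :
    wConj p q (-1 / z) = w p q z := by
  have hpc : (p : ℂ) ≠ 0 := by exact_mod_cast hp.ne'
  have hqc : (q : ℂ) ≠ 0 := by exact_mod_cast hq.ne'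
  have hz0 := ne_zero_of_im_pos hz
  have e1 : (p : ℂ) * (-1 / z) = -1 / (z / p) := by field_simp
  have e2 : (q : ℂ) * (-1 / z) = -1 / (z / q) := by field_simp
  have e3 : (p : ℂ) * q * (-1 / z) = -1 / (z / q / p) := by field_simp
  have hzq := div_natCast_im_pos hq hz
  have hzqp := div_natCast_im_pos hp hzq
  rw [wConj, w, e1, e2, e3, eta_neg_one_div (div_natCast_im_pos hp hz), eta_neg_one_div hzq,
    eta_neg_one_div hzqp, eta_neg_one_div hz, ← sqrt_mul_rootDivI_div hp z,
    ← sqrt_mul_rootDivI_div hp (z / q), mul_comm (p : ℂ) q, ← div_div z]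
  have h1 := rootDivI_ne_zero (div_natCast_im_pos hp hz)
  have h2 := rootDivI_ne_zero hzqp
  have h3 := sqrt_natCast_ne_zero hp
  have h4 := ModularForm.eta_ne_zero hz
  have h5 := ModularForm.eta_ne_zero hzqp
  generalize ModularForm.eta (z / q / p) = x at *
  generalize rootDivI (z / q / p) = r at *
  field_simp

lemma w_neg_one_div (hp : 0 < p) (hq : 0 < q) (hz : 0 < z.im) :
    w p q (-1 / z) = wConj p q z := by
  rw [← wConj_neg_one_div hp hq (im_neg_one_div_pos hz)]
  congr 1
  have hz0 := ne_zero_of_im_pos hz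
  field_simp

lemma c₂Quot_neg_one_div (hp : 0 < p) (hq : 0 < q) (hz : 0 < z.im) :
    c₂Quot p q (-1 / z) = c₂Quot q p z := by
  have hpc : (p : ℂ) ≠ 0 := by exact_mod_cast hp.ne'
  have hqc : (q : ℂ) ≠ 0 := by exact_mod_cast hq.ne'
  have hz0 := ne_zero_of_im_pos hz
  have e1 : (p : ℂ) * (-1 / z) = -1 / (z / p) := by field_simp
  have e2 : -1 / z / q = -1 / (q * z) := by field_simp
  have e3 : (p : ℂ) * (-1 / z) / q = -1 / (q * z / p) := by field_simp
  have hzq := natCast_mul_im_pos hq hz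
  have hzqp := div_natCast_im_pos hp hzq
  rw [c₂Quot, c₂Quot, e3, e1, e2, eta_neg_one_div (div_natCast_im_pos hp hz), eta_neg_one_div hzq,
    eta_neg_one_div hzqp, eta_neg_one_div hz, ← sqrt_mul_rootDivI_div hp z,
    ← sqrt_mul_rootDivI_div hp (q * z)]
  have h1 := rootDivI_ne_zero (div_natCast_im_pos hp hz)
  have h2 := rootDivI_ne_zero hzqp
  have h3 := sqrt_natCast_ne_zero hp
  have h4 := ModularForm.eta_ne_zero hz
  have h5 := ModularForm.eta_ne_zero hzqp
  generalize ModularForm.eta (q * z / p) = x at *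
  generalize rootDivI (q * z / p) = r at *
  field_simp

/-- `m` is the multiplier of `η` under a matrix with lower row `(n, -h)` and upper left entry `a`. -/
def IsMultiplier (n : ℕ) (a h : ℤ) (m : ℂ) : Prop := m ≠ 0 ∧ ∀ z : ℂ, 0 < z.im →
  ModularForm.eta ((a * z - 1) / (n * z)) = m * rootDivI z * ModularForm.eta ((z + h) / n)

lemma isMultiplier_multOdd {a k h : ℤ} (hq : Odd q) (hdet : 1 = -h * a + k * q) :
    IsMultiplier q a h (multOdd q a k h) := by
  refine ⟨mul_ne_zero ?_ (zpow_ne_zero _ zeta24_ne_zero), fun z hz ↦ eta_div_mul_of_odd hq hdet hz⟩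
  rw [Int.cast_ne_zero]
  exact jacobiSym.ne_zero (Int.isCoprime_iff_gcd_eq_one.mp ⟨a, k, by linarith⟩)

lemma isMultiplier_multRight {a k h : ℤ} (hq : 0 < q) (hh : Odd h) (hdet : 1 = -h * a + k * q) :
    IsMultiplier q a h (multRight q a k h) := by
  refine ⟨mul_ne_zero ?_ (zpow_ne_zero _ zeta24_ne_zero),
    fun z hz ↦ eta_div_mul_of_odd_right hq hh hdet hz⟩
  rw [Int.cast_ne_zero]
  refine jacobiSym.ne_zero ?_
  have : IsCoprime (q : ℤ) h := ⟨k, -a, by linarith⟩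
  have h1 := Int.isCoprime_iff_gcd_eq_one.mp this
  rw [Int.gcd] at h1 ⊢
  exact h1

lemma w_neg_one_div_add_of_coprime (hp : 0 < p) (hq : 0 < q) (hz : 0 < z.im) {ν ω : ℤ}
    {m m₁ m₂ m₃ m₄ : ℂ} (h₁ : IsMultiplier p ν ω m₁) (h₂ : IsMultiplier q ν ω m₂)
    (h₃ : IsMultiplier (p * q) ν ω m₃) (h₄ : IsMultiplier 1 ν ω m₄)
    (hm : m₁ * m₂ = m * (m₃ * m₄)) :
    w p q (-1 / z + ν) = m * w p q (z + ω) := by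
  have hz0 := ne_zero_of_im_pos hz
  have e (n : ℕ) (hn : 0 < n) : (-1 / z + ν) / n = (ν * z - 1) / (n * z) := by
    have : (n : ℂ) ≠ 0 := by exact_mod_cast hn.ne'
    field_simp
    ring
  have e3 := e _ (Nat.mul_pos hp hq)
  have e4 := e 1 one_pos
  have k3 := h₃.2 z hz
  have k4 := h₄.2 z hz
  push_cast at e3 e4 k3 k4
  rw [div_one] at e4 k4
  have hR := rootDivI_ne_zero hz
  rw [w, w, e p hp, e q hq, e3, e4, h₁.2 z hz, h₂.2 z hz, k3, k4]
  exact quotient_of_multipliers hm rfl (mul_ne_zero h₃.1 h₄.1) (mul_ne_zero hR hR)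

/-- When `p` divides the shift, the factors with denominators `p` and `1` need only `S` and
translations; the other two use matrices with lower left entry `q`. Numerator and denominator both
carry the root factors of `p z` and `z`. -/
lemma w_neg_one_div_add_mul (hp : 0 < p) (hq : 0 < q) (hz : 0 < z.im) {ρ h : ℤ}
    {m m₁ m₂ : ℂ} (h₁ : IsMultiplier q (p * ρ) h m₁) (h₂ : IsMultiplier q ρ (p * h) m₂)
    (hm : zeta24 ^ (ρ - p * h) * m₁ = m * (m₂ * zeta24 ^ (p * ρ - h))) :
    w p q (-1 / z + (p * ρ : ℤ)) = m * c₂Quot p q (z + h) := by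
  have hpc : (p : ℂ) ≠ 0 := by exact_mod_cast hp.ne'
  have hqc : (q : ℂ) ≠ 0 := by exact_mod_cast hq.ne'
  have hz0 := ne_zero_of_im_pos hz
  have hpz := natCast_mul_im_pos hp hz
  have e1 : (-1 / z + (p * ρ : ℤ)) / p = -1 / (p * z) + (ρ : ℤ) := by
    push_cast; field_simp
  have e2 : (-1 / z + (p * ρ : ℤ)) / q = ((p * ρ : ℤ) * z - 1) / (q * z) := by
    push_cast; field_simp; ring
  have e3 : (-1 / z + (p * ρ : ℤ)) / (p * q) = (ρ * (p * z) - 1) / (q * (p * z)) := by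
    push_cast; field_simp; ring
  have e4 : (p : ℂ) * z + (p * h : ℤ) = p * (z + h) := by push_cast; ring
  rw [w, e1, e2, e3, eta_add_neg_one_div hpz ρ (p * h), h₁.2 z hz, h₂.2 _ hpz,
    eta_add_neg_one_div hz _ h, e4, c₂Quot,
    mul_comm (ModularForm.eta (z + h)) (ModularForm.eta (p * (z + h) / q))]
  exact quotient_of_multipliers hm rfl (mul_ne_zero h₂.1 (zpow_ne_zero _ zeta24_ne_zero))
    (mul_ne_zero (rootDivI_ne_zero hpz) (rootDivI_ne_zero hz))

lemma c₂Quot_neg_one_div_add (hp : 0 < p) (hq : 0 < q) (hz : 0 < z.im) {ν μ : ℤ}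
    {m m₁ m₂ : ℂ} (h₁ : IsMultiplier q ν (μ * p) m₁) (h₂ : IsMultiplier q (ν * p) μ m₂)
    (hm : zeta24 ^ (ν * p - μ) * m₁ = m * (m₂ * zeta24 ^ (ν - μ * p))) :
    c₂Quot p q (-1 / z + ν) = m * w p q (z + (μ * p : ℤ)) := by
  have hpc : (p : ℂ) ≠ 0 := by exact_mod_cast hp.ne'
  have hqc : (q : ℂ) ≠ 0 := by exact_mod_cast hq.ne'
  have hz0 := ne_zero_of_im_pos hz
  have hpz := div_natCast_im_pos hp hz
  have e1 : p * (-1 / z + ν) = -1 / (z / p) + (ν * p : ℤ) := by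
    push_cast; field_simp
  have e2 : (-1 / z + ν) / q = (ν * z - 1) / (q * z) := by
    field_simp; ring
  have e3 : p * (-1 / z + ν) / q = ((ν * p : ℤ) * (z / p) - 1) / (q * (z / p)) := by
    push_cast; field_simp; ring
  have e4 : (z : ℂ) / p + μ = (z + (μ * p : ℤ)) / p := by push_cast; field_simp
  rw [c₂Quot, e3, e1, e2, eta_add_neg_one_div hpz _ μ, h₁.2 z hz, h₂.2 _ hpz,
    eta_add_neg_one_div hz _ (μ * p), e4, w, div_div,
    mul_comm (zeta24 ^ (ν - μ * p) * _ * _)]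
  exact quotient_of_multipliers hm rfl (mul_ne_zero h₂.1 (zpow_ne_zero _ zeta24_ne_zero))
    (mul_ne_zero (rootDivI_ne_zero hpz) (rootDivI_ne_zero hz))

/-- Both numerator factors carry the root of `p z`, the denominator those of `p z` and `z`. The
uncancelled ratio is the `√p` in `C`. -/
lemma w_self_neg_one_div_add (hp : 0 < p) (hz : 0 < z.im) {ρ h : ℤ} {m m₁ : ℂ}
    (h₁ : IsMultiplier p ρ h m₁) (hm : zeta24 ^ (2 * ρ) = m * (zeta24 ^ (ρ * p) * m₁)) :
    w p p (-1 / z + (ρ * p : ℤ)) = m * (Real.sqrt p * (ModularForm.eta (p * z) ^ 2 /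
      (ModularForm.eta z * ModularForm.eta (z + h / p)))) := by
  have hpc : (p : ℂ) ≠ 0 := by exact_mod_cast hp.ne'
  have hz0 := ne_zero_of_im_pos hz
  have hpz := natCast_mul_im_pos hp hz
  have e1 : (-1 / z + (ρ * p : ℤ)) / p = -1 / (p * z) + (ρ : ℤ) := by
    push_cast; field_simp
  have e2 : (-1 / z + (ρ * p : ℤ)) / (p * p) = (ρ * (p * z) - 1) / (p * (p * z)) := by
    push_cast; field_simp; ring
  have e3 : (p * z + h) / p = z + h / p := by field_simp
  have key := eta_add_neg_one_div hz (ρ * p) 0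
  rw [Int.cast_zero, add_zero, sub_zero] at key
  have key' := eta_add_neg_one_div hpz ρ 0
  rw [Int.cast_zero, add_zero, sub_zero] at key'
  rw [w, e1, e2, h₁.2 _ hpz, key, key', e3, ← mul_assoc m, sq,
    mul_comm (ModularForm.eta z) (ModularForm.eta _)]
  have h1 := rootDivI_ne_zero hz
  have h2 := rootDivI_ne_zero hpz
  have h3 : zeta24 ^ (2 * ρ) = zeta24 ^ ρ * zeta24 ^ ρ := by
    rw [← zpow_add₀ zeta24_ne_zero, two_mul]
  rw [h3] at hm
  have := quotient_of_multipliers (m := m * Real.sqrt p) (m₁ := zeta24 ^ ρ * Real.sqrt p)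
    (m₂ := zeta24 ^ ρ) (m₃ := m₁)
    (m₄ := zeta24 ^ (ρ * p)) (r₁ := rootDivI z) (r₂ := rootDivI (p * z)) (r₃ := rootDivI (p * z))
    (r₄ := rootDivI z) (x₁ := ModularForm.eta (p * z)) (x₂ := ModularForm.eta (p * z))
    (x₃ := ModularForm.eta (z + h / p)) (x₄ := ModularForm.eta z)
    (by linear_combination (Real.sqrt p : ℂ) * hm) (mul_comm _ _)
    (mul_ne_zero h₁.1 (zpow_ne_zero _ zeta24_ne_zero)) (mul_ne_zero h2 h1)
  rw [← this]
  congr 1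
  rw [rootDivI_natCast_mul hp z]
  ring

lemma sqrt_mul_eta_quotient_neg_one_div (hp : 0 < p) (hz : 0 < z.im) {ν μ : ℤ} {m m₁ : ℂ}
    (h₁ : IsMultiplier p ν μ m₁) (hm : zeta24 ^ (-2 * μ) = m * (zeta24 ^ (-μ * p) * m₁)) :
    Real.sqrt p * (ModularForm.eta (p * (-1 / z)) ^ 2 /
      (ModularForm.eta (-1 / z) * ModularForm.eta (-1 / z + ν / p))) =
      m * w p p (z + (μ * p : ℤ)) := by
  have hpc : (p : ℂ) ≠ 0 := by exact_mod_cast hp.ne'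
  have hz0 := ne_zero_of_im_pos hz
  have hpz := div_natCast_im_pos hp hz
  have e1 : p * (-1 / z) = -1 / (z / p) + (0 : ℤ) := by
    push_cast; field_simp; simp
  have e2 : -1 / z + ν / p = (ν * (z / p) - 1) / (p * (z / p)) := by
    field_simp; ring
  have e3 : z / p + μ = (z + (μ * p : ℤ)) / p := by push_cast; field_simp
  have key := eta_add_neg_one_div hz 0 (μ * p)
  rw [Int.cast_zero, add_zero] at key
  rw [e1, e2, h₁.2 _ hpz, key, eta_add_neg_one_div hpz 0 μ, e3, div_div, w,
    mul_comm (ModularForm.eta ((z + (μ * p : ℤ)) / (p * p))), ← mul_div_assoc]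
  have h1 := rootDivI_ne_zero hz
  have h2 := rootDivI_ne_zero hpz
  have h3 : zeta24 ^ (-2 * μ) = zeta24 ^ (0 - μ) * zeta24 ^ (0 - μ) := by
    rw [← zpow_add₀ zeta24_ne_zero]
    congr 1
    ring
  rw [h3, show -μ * p = 0 - μ * p by ring] at hm
  rw [← quotient_of_multipliers hm (r₁ := rootDivI z) (r₂ := rootDivI (z / p)) rfl
    (mul_ne_zero (zpow_ne_zero _ zeta24_ne_zero) h₁.1) (mul_ne_zero h1 h2)]
  congr 1
  rw [← sqrt_mul_rootDivI_div hp z]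
  ring

end Transformations

/-! ### Quotients of multipliers as a symbol times a power of `φ`. -/

lemma jacobiSym_mul_zpow_mul {j₁ j₂ j₃ j₄ a b c d t : ℤ} (hj : j₁ * j₂ = j₃ * j₄)
    (hx : a + b = t + (c + d)) :
    (j₁ * zeta24 ^ a) * (j₂ * zeta24 ^ b) =
      zeta24 ^ t * ((j₃ * zeta24 ^ c) * (j₄ * zeta24 ^ d)) := by
  have hj' : (j₁ : ℂ) * j₂ = j₃ * j₄ := by exact_mod_cast hj
  have hx' : zeta24 ^ a * zeta24 ^ b = zeta24 ^ t * (zeta24 ^ c * zeta24 ^ d) := by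
    simp only [← zpow_add₀ zeta24_ne_zero, hx]
  linear_combination zeta24 ^ a * zeta24 ^ b * hj' + (j₃ * j₄ : ℂ) * hx'

lemma jacobiSym_mul_zpow {j j₁ j₂ a b c d t : ℤ} (hj : j₁ = j * j₂)
    (hx : a + b = t + (c + d)) :
    zeta24 ^ a * (j₁ * zeta24 ^ b) = (j * zeta24 ^ t) * ((j₂ * zeta24 ^ c) * zeta24 ^ d) := by
  have hx' : zeta24 ^ a * zeta24 ^ b = zeta24 ^ t * (zeta24 ^ c * zeta24 ^ d) := by
    simp only [← zpow_add₀ zeta24_ne_zero, hx]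
  rw [hj]
  push_cast
  linear_combination (j * j₂ : ℂ) * hx'

section Multipliers

variable {p q : ℕ}

lemma jacobiSym_two_self {a : ℤ} (h : IsCoprime a p) : J(a | p) * J(a | p) = 1 := by
  rw [← sq]
  exact jacobiSym.sq_one (Int.isCoprime_iff_gcd_eq_one.mp h)

/-- The symbols cancel by multiplicativity in the lower argument, and the exponents differ by a
multiple of `(p - 1)(q - 1)`. For `multRight` multiplicativity in the upper argument plays this
role. -/
lemma multOdd_coprime (hp : 0 < p) (hq : 0 < q) (ν ω v : ℤ) :
    multOdd p ν (v * q) ω * multOdd q ν (v * p) ω =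
      phi p q ^ (ω + 3 - ν + ω * v * (p * q - 1)) *
        (multOdd (p * q) ν v ω * multOdd 1 ν (v * (p * q)) ω) := by
  rw [phi_zpow hp hq]
  refine jacobiSym_mul_zpow_mul ?_ ?_
  · rw [jacobiSym.mul_right' _ hp.ne' hq.ne', jacobiSym.one_right, mul_one]
  · push_cast
    ring

lemma multRight_coprime (hp : 0 < p) (hq : 0 < q) (ν ω v : ℤ) :
    multRight p ν (v * q) ω * multRight q ν (v * p) ω =
      phi p q ^ (-(ω * v + ω - ν * (ω ^ 2 - 1))) *
        (multRight (p * q) ν v ω * multRight 1 ν (v * (p * q)) ω) := by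
  rw [phi_zpow hp hq]
  refine jacobiSym_mul_zpow_mul ?_ ?_
  · push_cast
    rw [jacobiSym.mul_left, jacobiSym.one_left, mul_one]
  · push_cast
    ring

/-- The entries `h` and `p h` differ by the factor `p`, so one symbol `(p/q)` survives; it becomes
`ε₂`. -/
lemma multOdd_mul (hp : 0 < p) (hq : 0 < q) (hpq : IsCoprime (p : ℤ) q) (ρ h k : ℤ) :
    zeta24 ^ (ρ - p * h) * multOdd q (p * ρ) k h =
      (J(p | q) * phi p q ^ (ρ + h + k * h * (q + 1))) *
        (multOdd q ρ k (p * h) * zeta24 ^ (p * ρ - h)) := by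
  rw [phi_zpow hp hq]
  refine jacobiSym_mul_zpow ?_ ?_
  · rw [← mul_neg, jacobiSym.mul_left, ← mul_assoc, jacobiSym_two_self hpq, one_mul]
  · ring

lemma multRight_mul (hp : Odd p) {ρ h : ℤ} (hh : h ≠ 0) (k : ℤ) :
    zeta24 ^ (ρ - p * h) * multRight 2 (p * ρ) k h =
      (J(2 | p) * phi p 2 ^ (ρ + 2 * ρ * p * h ^ 2 - k * h)) *
        (multRight 2 ρ k (p * h) * zeta24 ^ (p * ρ - h)) := by
  rw [phi_zpow hp.pos two_pos]
  refine jacobiSym_mul_zpow ?_ ?_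
  · have h2 : J(2 | p) * J(2 | p) = 1 := jacobiSym_two_self
      (Int.isCoprime_iff_gcd_eq_one.mpr (by simpa [Int.gcd] using hp))
    rw [Int.natAbs_mul, Int.natAbs_natCast,
      jacobiSym.mul_right' _ hp.pos.ne' (Int.natAbs_ne_zero.mpr hh), ← mul_assoc]
    push_cast
    rw [h2, one_mul]
  · push_cast
    ring

lemma multOdd_mul' (hp : 0 < p) (hq : 0 < q) (ν μ k : ℤ) :
    zeta24 ^ (ν * p - μ) * multOdd q ν k (μ * p) =
      (J(p | q) * phi p q ^ (-(ν + μ + k * μ * (q + 1)))) *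
        (multOdd q (ν * p) k μ * zeta24 ^ (ν - μ * p)) := by
  rw [phi_zpow hp hq]
  refine jacobiSym_mul_zpow ?_ ?_
  · rw [← neg_mul, jacobiSym.mul_left, mul_comm]
  · ring

lemma multRight_mul' (hp : Odd p) {ν μ : ℤ} (hμ : μ ≠ 0) (k : ℤ) :
    zeta24 ^ (ν * p - μ) * multRight 2 ν k (μ * p) =
      (J(2 | p) * phi p 2 ^ (k * μ - ν - 2 * ν * p * μ ^ 2)) *
        (multRight 2 (ν * p) k μ * zeta24 ^ (ν - μ * p)) := by
  rw [phi_zpow hp.pos two_pos]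
  refine jacobiSym_mul_zpow ?_ ?_
  · rw [Int.natAbs_mul, Int.natAbs_natCast,
      jacobiSym.mul_right' _ (Int.natAbs_ne_zero.mpr hμ) hp.pos.ne', mul_comm]
    push_cast
    rfl
  · push_cast
    ring

end Multipliers

/-! ### Coprime shifts for any `p`, `q`, and the conjugates `C₂` for `p ≠ q`. -/

section Conjugates

variable {p q e : ℕ}

lemma delta_eq_three_of_even (h : e ∣ s p q) (hne : e ≠ s p q)
    (hN : p * q ≡ 1 [MOD delta p q e]) (heven : Even (p * q)) : delta p q e = 3 := by
  have h2 : ¬ 2 ∣ delta p q e := by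
    intro h2
    obtain ⟨hp, hq⟩ := odd_mul_of_two_dvd_delta hN h2
    exact Nat.not_even_iff_odd.mpr (hp.mul hq) heven
  rcases delta_cases h hne hN with hd | hd | hd
  · exact absurd (by rw [hd]) h2
  · exact hd
  · exact absurd (by rw [hd]; norm_num) h2

lemma delta_dvd_mul_sub_one (hN : p * q ≡ 1 [MOD delta p q e]) :
    (delta p q e : ℤ) ∣ p * q - 1 := by
  exact_mod_cast (Nat.modEq_iff_dvd.mp hN.symm)

lemma compS_eq_smul_iff {f g : ℍ → ℂ} {c : ℂ} :
    compS f = c • g ↔ ∀ z : ℍ, f (ModularGroup.S • z) = c * g z := by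
  rw [funext_iff]
  rfl

/-- The `e`-th power turns `φ ^ t` into `χ ^ (-t)`, which leaves a congruence modulo `δ`. -/
lemma compS_A'_of_eq (hp : 0 < p) (hq : 0 < q) (h : e ∣ s p q) {ν ω t : ℤ}
    (hw : ∀ z : ℂ, 0 < z.im → w p q (-1 / z + ν) = phi p q ^ t * w p q (z + ω))
    (ht : (delta p q e : ℤ) ∣ ω - ν - t - alpha0 (delta p q e)) :
    compS (A' p q e ν) = chi p q e ^ alpha0 (delta p q e) • A' p q e ω := by
  rw [compS_eq_smul_iff]
  intro z
  rw [A', A', A, A, coe_S_smul, hw z z.im_pos, mul_pow, phi_zpow_pow, ← mul_assoc, ← mul_assoc,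
    ← zpow_add₀ (chi_ne_zero p q e), ← zpow_add₀ (chi_ne_zero p q e)]
  congr 1
  apply chi_zpow_congr hp hq h
  convert! ht using 1
  ring

theorem compS_A'_of_coprime (hp : 0 < p) (hq : 0 < q) (h : e ∣ s p q) (hne : e ≠ s p q)
    (hN : p * q ≡ 1 [MOD delta p q e]) {ν ω v : ℤ} (hdet : 1 = -ω * ν + v * (p * q)) :
    compS (A' p q e ν) = chi p q e ^ alpha0 (delta p q e) • A' p q e ω := by
  have h1 : 1 = -ω * ν + v * q * p := by linarith
  have h2 : 1 = -ω * ν + v * p * q := by linarith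
  have h3 : 1 = -ω * ν + v * (p * q : ℕ) := by push_cast; linarith
  have h4 : 1 = -ω * ν + v * (p * q) * (1 : ℕ) := by push_cast; linarith
  obtain ⟨n, hn⟩ := delta_dvd_mul_sub_one hN
  rcases Nat.even_or_odd (p * q) with heven | hodd
  -- If `p q` is even, the determinant relation forces `ω` odd, so the multiplier form for odd lower
  -- right entry applies.
  · have hω : Odd ω := by
      have : Even ((p : ℤ) * q) := by exact_mod_cast heven
      have h5 : Odd (ω * ν) := by
        have h6 := this.mul_left v
        obtain ⟨m, hm⟩ := h6
        exact ⟨m - 1, by linarith⟩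
      exact (Int.odd_mul.mp h5).1
    have hd := delta_eq_three_of_even h hne hN heven
    refine compS_A'_of_eq hp hq h (fun z hz ↦ w_neg_one_div_add_of_coprime hp hq hz
      (isMultiplier_multRight hp hω h1) (isMultiplier_multRight hq hω h2)
      (isMultiplier_multRight (Nat.mul_pos hp hq) hω h3)
      (isMultiplier_multRight one_pos hω h4) (multRight_coprime hp hq ν ω v)) ?_
    rw [hd] at hn ⊢
    refine ⟨ω - ω * v * n, ?_⟩
    simp only [alpha0]
    push_cast at hn ⊢
    norm_num
    linear_combination -ω * hdet - ω * v * hn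
  · obtain ⟨hpo, hqo⟩ := Nat.odd_mul.mp hodd
    refine compS_A'_of_eq hp hq h (fun z hz ↦ w_neg_one_div_add_of_coprime hp hq hz
      (isMultiplier_multOdd hpo h1) (isMultiplier_multOdd hqo h2)
      (isMultiplier_multOdd hodd h3)
      (isMultiplier_multOdd odd_one h4) (multOdd_coprime hp hq ν ω v)) ?_
    obtain ⟨c, hc⟩ := (delta_dvd_alpha0 h hne hN).2
    refine ⟨-c - ω * v * n, ?_⟩
    linear_combination -hc - ω * v * hn

theorem compS_B' (hp : 0 < p) (hq : 0 < q) (h : e ∣ s p q) (hne : e ≠ s p q)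
    (hN : p * q ≡ 1 [MOD delta p q e]) :
    compS (B' p q e) = chi p q e ^ alpha0 (delta p q e) • A' p q e 0 := by
  rw [compS_eq_smul_iff]
  intro z
  have h1 : chi p q e ^ alpha0 (delta p q e) * chi p q e ^ (alpha0 (delta p q e) - 0) = 1 := by
    rw [← zpow_add₀ (chi_ne_zero p q e), ← zpow_zero (chi p q e)]
    apply chi_zpow_congr hp hq h
    convert! (delta_dvd_alpha0 h hne hN).1 using 1
    ring
  have h2 : B p q (ModularGroup.S • z) = A p q 0 z := by
    have := wConj_neg_one_div hp hq z.im_pos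
    rw [A, B, coe_S_smul, Int.cast_zero, add_zero, ← this]
    rfl
  rw [B', A', h2, ← mul_assoc, h1, one_mul]

theorem compS_A'_zero (hp : 0 < p) (hq : 0 < q) :
    compS (A' p q e 0) = chi p q e ^ alpha0 (delta p q e) • B' p q e := by
  rw [compS_eq_smul_iff]
  intro z
  have h2 : A p q 0 (ModularGroup.S • z) = B p q z := by
    rw [A, B, coe_S_smul, Int.cast_zero, add_zero, w_neg_one_div hp hq z.im_pos]
    rfl
  rw [B', A', h2, sub_zero]

/-- The `e`-th power of `φ ^ θ₂` is `χ ^ (-θ₂)`, so `θ₂` cancels against the prefactor. -/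
lemma C₂'_apply [Fact q.Prime] (u v ν : ℤ) (z : ℍ) :
    C₂' p q u v e ν z = chi p q e ^ (-ν) * (eps₂ p q : ℂ) ^ e * c₂Quot p q (z + ν) ^ e := by
  have : C₂ p q u v ν z = phi p q ^ theta₂ p q u v ν * (eps₂ p q : ℂ) * c₂Quot p q (z + ν) := rfl
  rw [C₂', this, mul_pow, mul_pow, phi_zpow_pow, ← mul_assoc, ← mul_assoc,
    ← zpow_add₀ (chi_ne_zero p q e)]
  congr 3
  ring

/-- The Jacobi symbol by which the multipliers in the cases of `C₂` differ. -/
noncomputable def crossSym (p q : ℕ) : ℤ := if q = 2 then J(2 | p) else J(p | q)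

lemma jacobiSym_two_pow_eq_one (hp : Odd p) (h : e ∣ s p 2) (hd : delta p 2 e = 3) :
    J(2 | p) ^ e = 1 := by
  have h2 : J(2 | p) ^ 2 = 1 := jacobiSym.sq_one (by simpa [Int.gcd] using hp)
  rcases even_or_eight_dvd h hd with he | h8
  · obtain ⟨m, rfl⟩ := he
    rw [← two_mul, pow_mul, h2, one_pow]
  · obtain ⟨m, hm⟩ := hp
    have : p % 8 = 1 := by lia
    rw [jacobiSym.at_two ⟨m, hm⟩, ZMod.χ₈_nat_eq_if_mod_eight, if_neg (by lia), if_pos (by lia),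
      one_pow]

lemma eps₂_sq [Fact p.Prime] [hq : Fact q.Prime] (hpq : p ≠ q) : eps₂ p q ^ 2 = 1 := by
  rw [eps₂]
  split_ifs
  · rfl
  · apply legendreSym.sq_one
    rw [Int.cast_natCast, Ne, ZMod.natCast_eq_zero_iff]
    exact fun h ↦ hpq ((Nat.prime_dvd_prime_iff_eq hq.out Fact.out).mp h).symm

lemma crossSym_pow [hp : Fact p.Prime] [Fact q.Prime] (hpq : p ≠ q) (h : e ∣ s p q)
    (hne : e ≠ s p q) (hN : p * q ≡ 1 [MOD delta p q e]) :
    crossSym p q ^ e = eps₂ p q ^ e := by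
  rw [crossSym, eps₂]
  split_ifs with h2
  · subst h2
    rw [one_pow]
    exact jacobiSym_two_pow_eq_one (hp.out.odd_of_ne_two hpq) h
      (delta_eq_three_of_even h hne hN (even_two.mul_left p))
  · rw [jacobiSym.legendreSym.to_jacobiSym]

lemma eps₂_pow_eq_of_odd_of_two [Fact p.Prime] [Fact (Nat.Prime 2)] (hp : Odd p) (h : e ∣ s p 2)
    (hne : e ≠ s p 2) (hN : p * 2 ≡ 1 [MOD delta p 2 e]) :
    eps₂ 2 p ^ e = 1 ∧ eps₂ p 2 ^ e = 1 := by
  have hp2 : p ≠ 2 := by rintro rfl; exact absurd hp (by decide)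
  rw [eps₂, eps₂, if_neg hp2, if_pos rfl, jacobiSym.legendreSym.to_jacobiSym, one_pow]
  exact ⟨jacobiSym_two_pow_eq_one hp h (delta_eq_three_of_even h hne hN (even_two.mul_left p)),
    rfl⟩

/-- This is quadratic reciprocity raised to the power `e`. For even `δ` the sign is `-1` and `e` is
odd, matching `χ ^ α₀ = -1`; for `δ = 3` the sign disappears and `α₀ = 0`. -/
lemma eps₂_pow_swap [hp : Fact p.Prime] [hq : Fact q.Prime] (hpq : p ≠ q) (h : e ∣ s p q)
    (hne : e ≠ s p q) (hN : p * q ≡ 1 [MOD delta p q e]) :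
    (eps₂ p q : ℂ) ^ e = chi p q e ^ alpha0 (delta p q e) * (eps₂ q p : ℂ) ^ e := by
  by_cases h2 : 2 ∣ delta p q e
  · obtain ⟨hp4, hq4, heo, -⟩ := even_delta h hN h2
    rw [chi_zpow_alpha0_of_even hp.out.pos hq.out.pos h hne hN h2, eps₂, eps₂,
      if_neg (by rintro rfl; lia), if_neg (by rintro rfl; lia),
      jacobiSym.legendreSym.to_jacobiSym, jacobiSym.legendreSym.to_jacobiSym,
      jacobiSym.quadratic_reciprocity_three_mod_four hp4 hq4]
    push_cast
    rw [heo.neg_pow, neg_one_mul]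
  have hd : delta p q e = 3 := by
    rcases delta_cases h hne hN with hd | hd | hd
    · exact absurd (by rw [hd]) h2
    · exact hd
    · exact absurd (by rw [hd]; norm_num) h2
  have key : eps₂ p q ^ e = eps₂ q p ^ e := by
    rcases eq_or_ne p 2 with rfl | hp2
    · rw [delta_comm] at hN
      rw [s, mul_comm, ← s] at h hne
      rw [mul_comm] at hN
      obtain ⟨h1, h2⟩ := eps₂_pow_eq_of_odd_of_two (hq.out.odd_of_ne_two hpq.symm) h hne hN
      rw [h1, h2]
    rcases eq_or_ne q 2 with rfl | hq2
    · obtain ⟨h1, h2⟩ := eps₂_pow_eq_of_odd_of_two (hp.out.odd_of_ne_two hpq) h hne hN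
      rw [h1, h2]
    rcases even_or_eight_dvd h hd with he | h8
    · obtain ⟨m, rfl⟩ := he
      rw [← two_mul, pow_mul, pow_mul, eps₂_sq hpq, eps₂_sq hpq.symm]
    · congr 1
      obtain ⟨m, hm⟩ := hp.out.odd_of_ne_two hp2
      obtain ⟨n, hn⟩ := hq.out.odd_of_ne_two hq2
      rw [eps₂, eps₂, if_neg hp2, if_neg hq2, jacobiSym.legendreSym.to_jacobiSym,
        jacobiSym.legendreSym.to_jacobiSym, jacobiSym.quadratic_reciprocity ⟨m, hm⟩ ⟨n, hn⟩,
        Even.neg_one_pow, one_mul]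
      rw [show p / 2 = m by lia, show q / 2 = n by lia, even_iff_two_dvd]
      rw [hm, hn, Nat.add_sub_cancel, Nat.add_sub_cancel,
        show 2 * m * (2 * n) = 4 * (m * n) by ring] at h8
      lia
  rw [hd, alpha0, if_neg (by norm_num), if_pos rfl, zpow_zero, one_mul]
  exact_mod_cast key

/-- The quotients are exchanged by `S` without any multiplier, so the factor `χ ^ α₀` comes from the
reciprocity sign alone. -/
theorem compS_C₂'_zero [hp : Fact p.Prime] [hq : Fact q.Prime] (hpq : p ≠ q) (h : e ∣ s p q)
    (hne : e ≠ s p q) (hN : p * q ≡ 1 [MOD delta p q e]) (u v : ℤ) :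
    compS (C₂' p q u v e 0) = chi p q e ^ alpha0 (delta p q e) • C₁' p q u v e 0 := by
  rw [compS_eq_smul_iff]
  intro z
  rw [C₁', C₂'_apply, C₂'_apply, coe_S_smul, Int.cast_zero, add_zero, add_zero,
    c₂Quot_neg_one_div hp.out.pos hq.out.pos z.im_pos, eps₂_pow_swap hpq h hne hN, neg_zero,
    zpow_zero, zpow_zero]
  ring

lemma compS_A'_mul_of_eq [hp : Fact p.Prime] [hq : Fact q.Prime] (hpq : p ≠ q) (h : e ∣ s p q)
    (hne : e ≠ s p q) (hN : p * q ≡ 1 [MOD delta p q e]) {ν ϖ t : ℤ} (u v : ℤ)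
    (hw : ∀ z : ℂ, 0 < z.im → w p q (-1 / z + ν) =
      (crossSym p q * phi p q ^ t) * c₂Quot p q (z + ϖ))
    (ht : (delta p q e : ℤ) ∣ ϖ - ν - t) :
    compS (A' p q e ν) = chi p q e ^ alpha0 (delta p q e) • C₂' p q u v e ϖ := by
  rw [compS_eq_smul_iff]
  intro z
  have hs : (crossSym p q : ℂ) ^ e = (eps₂ p q : ℂ) ^ e := by
    exact_mod_cast crossSym_pow hpq h hne hN
  have hc : chi p q e ^ (alpha0 (delta p q e) - ν) * chi p q e ^ (-t) =
      chi p q e ^ alpha0 (delta p q e) * chi p q e ^ (-ϖ) := by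
    rw [← zpow_add₀ (chi_ne_zero p q e), ← zpow_add₀ (chi_ne_zero p q e)]
    apply chi_zpow_congr hp.out.pos hq.out.pos h
    convert! ht using 1
    ring
  rw [A', A, C₂'_apply, coe_S_smul, hw z z.im_pos, mul_pow, mul_pow, phi_zpow_pow, hs]
  linear_combination (eps₂ p q : ℂ) ^ e * c₂Quot p q (z + ϖ) ^ e * hc

theorem compS_A'_mul [hp : Fact p.Prime] [hq : Fact q.Prime] (hpq : p ≠ q) (h : e ∣ s p q)
    (hne : e ≠ s p q) (hN : p * q ≡ 1 [MOD delta p q e]) {ρ ϖ k : ℤ} (u v : ℤ)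
    (hdet : 1 = -ϖ * (p * ρ) + k * q) :
    compS (A' p q e (p * ρ)) = chi p q e ^ alpha0 (delta p q e) • C₂' p q u v e ϖ := by
  have hdet' : 1 = -(p * ϖ) * ρ + k * q := by linarith
  rcases eq_or_ne q 2 with rfl | hq2
  · have hpo := hp.out.odd_of_ne_two hpq
    have hϖ : Odd ϖ := by
      have : Odd (ϖ * (p * ρ)) := ⟨k - 1, by push_cast at hdet; linarith⟩
      exact (Int.odd_mul.mp this).1
    have hϖ0 : ϖ ≠ 0 := by rintro rfl; simp at hϖ
    have hpϖ : Odd (p * ϖ) := (by exact_mod_cast hpo : Odd (p : ℤ)).mul hϖ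
    refine compS_A'_mul_of_eq hpq h hne hN u v (fun z hz ↦ w_neg_one_div_add_mul hp.out.pos
      two_pos hz (isMultiplier_multRight two_pos hϖ hdet)
      (isMultiplier_multRight two_pos hpϖ hdet') (multRight_mul hpo hϖ0 k)) ?_
    have hd := delta_eq_three_of_even h hne hN (even_two.mul_left p)
    obtain ⟨a, ha⟩ := (delta_dvd_succ h hne hN).1
    rw [hd] at ha ⊢
    push_cast at ha hdet ⊢
    refine ⟨-ρ * a + ϖ - k * ϖ, ?_⟩
    linear_combination -ρ * ha - 2 * ϖ * hdet
  · refine compS_A'_mul_of_eq hpq h hne hN u v (fun z hz ↦ ?_) (t := ρ + ϖ + k * ϖ * (q + 1)) ?_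
    · have hqo := hq.out.odd_of_ne_two hq2
      have hcop : IsCoprime (p : ℤ) q :=
        Nat.isCoprime_iff_coprime.mpr ((Nat.coprime_primes hp.out hq.out).mpr hpq)
      rw [crossSym, if_neg hq2]
      exact w_neg_one_div_add_mul hp.out.pos hq.out.pos hz (isMultiplier_multOdd hqo hdet)
        (isMultiplier_multOdd hqo hdet') (multOdd_mul hp.out.pos hq.out.pos hcop ρ ϖ k)
    · obtain ⟨⟨a, ha⟩, b, hb⟩ := delta_dvd_succ h hne hN
      refine ⟨-ρ * a - k * ϖ * b, ?_⟩
      linear_combination -ρ * ha - k * ϖ * hb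

lemma compS_C₂'_of_eq [hp : Fact p.Prime] [hq : Fact q.Prime] (hpq : p ≠ q) (h : e ∣ s p q)
    (hne : e ≠ s p q) (hN : p * q ≡ 1 [MOD delta p q e]) {ν ω t : ℤ} (u v : ℤ)
    (hw : ∀ z : ℂ, 0 < z.im → c₂Quot p q (-1 / z + ν) =
      (crossSym p q * phi p q ^ t) * w p q (z + ω))
    (ht : (delta p q e : ℤ) ∣ ω - ν - t - 2 * alpha0 (delta p q e)) :
    compS (C₂' p q u v e ν) = chi p q e ^ alpha0 (delta p q e) • A' p q e ω := by
  rw [compS_eq_smul_iff]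
  intro z
  have hs : (crossSym p q : ℂ) ^ e = (eps₂ p q : ℂ) ^ e := by
    exact_mod_cast crossSym_pow hpq h hne hN
  have hs2 : (eps₂ p q : ℂ) ^ e * (eps₂ p q : ℂ) ^ e = 1 := by
    rw [← mul_pow, ← sq]
    have : (eps₂ p q : ℂ) ^ 2 = 1 := by exact_mod_cast eps₂_sq hpq
    rw [this, one_pow]
  have hc : chi p q e ^ (-ν) * chi p q e ^ (-t) =
      chi p q e ^ alpha0 (delta p q e) * chi p q e ^ (alpha0 (delta p q e) - ω) := by
    rw [← zpow_add₀ (chi_ne_zero p q e), ← zpow_add₀ (chi_ne_zero p q e)]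
    apply chi_zpow_congr hp.out.pos hq.out.pos h
    convert! ht using 1
    ring
  rw [A', A, C₂'_apply, coe_S_smul, hw z z.im_pos, mul_pow, mul_pow, phi_zpow_pow, hs]
  linear_combination chi p q e ^ (-ν) * chi p q e ^ (-t) * w p q (z + ω) ^ e * hs2 +
    w p q (z + ω) ^ e * hc

theorem compS_C₂' [hp : Fact p.Prime] [hq : Fact q.Prime] (hpq : p ≠ q) (h : e ∣ s p q)
    (hne : e ≠ s p q) (hN : p * q ≡ 1 [MOD delta p q e]) {ν μ k : ℤ} (u v : ℤ)
    (hdet : 1 = -(μ * p) * ν + k * q) :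
    compS (C₂' p q u v e ν) = chi p q e ^ alpha0 (delta p q e) • A' p q e (μ * p) := by
  have hdet' : 1 = -μ * (ν * p) + k * q := by linarith
  rcases eq_or_ne q 2 with rfl | hq2
  · have hpo := hp.out.odd_of_ne_two hpq
    have hμp : Odd (μ * p) := by
      have : Odd (μ * p * ν) := ⟨k - 1, by push_cast at hdet; linarith⟩
      exact (Int.odd_mul.mp this).1
    have hμ := (Int.odd_mul.mp hμp).1
    have hμ0 : μ ≠ 0 := by rintro rfl; simp at hμ
    refine compS_C₂'_of_eq hpq h hne hN u v (fun z hz ↦ c₂Quot_neg_one_div_add hp.out.pos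
      two_pos hz (isMultiplier_multRight two_pos hμp hdet)
      (isMultiplier_multRight two_pos hμ hdet') (multRight_mul' hpo hμ0 k)) ?_
    have hd := delta_eq_three_of_even h hne hN (even_two.mul_left p)
    obtain ⟨a, ha⟩ := (delta_dvd_succ h hne hN).1
    rw [hd] at ha ⊢
    simp only [alpha0]
    push_cast at ha hdet ⊢
    norm_num
    refine ⟨μ * a + k * μ - μ, ?_⟩
    linear_combination μ * ha + 2 * μ * hdet
  · refine compS_C₂'_of_eq hpq h hne hN u v (fun z hz ↦ ?_)
      (t := -(ν + μ + k * μ * (q + 1))) ?_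
    · have hqo := hq.out.odd_of_ne_two hq2
      rw [crossSym, if_neg hq2]
      exact c₂Quot_neg_one_div_add hp.out.pos hq.out.pos hz (isMultiplier_multOdd hqo hdet)
        (isMultiplier_multOdd hqo hdet') (multOdd_mul' hp.out.pos hq.out.pos ν μ k)
    · obtain ⟨⟨a, ha⟩, b, hb⟩ := delta_dvd_succ h hne hN
      obtain ⟨c, hc⟩ := (delta_dvd_alpha0 h hne hN).1
      refine ⟨μ * a + k * μ * b - c, ?_⟩
      linear_combination μ * ha + k * μ * hb - hc

end Conjugates

/-! ### The case of equal primes. -/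

section SamePrime

variable {p e : ℕ}

lemma w_add_mul (hp : 0 < p) {q : ℕ} (hq : 0 < q) (x : ℂ) (n : ℤ) :
    w p q (x + (n * (p * q) : ℤ)) = phi p q ^ (-n) * w p q x := by
  have hpc : (p : ℂ) ≠ 0 := by exact_mod_cast hp.ne'
  have hqc : (q : ℂ) ≠ 0 := by exact_mod_cast hq.ne'
  have e1 : (x + (n * (p * q) : ℤ)) / p = x / p + (n * q : ℤ) := by push_cast; field_simp
  have e2 : (x + (n * (p * q) : ℤ)) / q = x / q + (n * p : ℤ) := by push_cast; field_simp
  have e3 : (x + (n * (p * q) : ℤ)) / (p * q) = x / (p * q) + n := by push_cast; field_simp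
  rw [w, e1, e2, e3]
  simp only [eta_add_intCast]
  rw [w, phi_zpow hp hq]
  have h := quotient_of_multipliers (r₁ := 1) (r₂ := 1) (r₃ := 1) (r₄ := 1)
    (m := zeta24 ^ (((p : ℤ) - 1) * (q - 1) * -n)) (m₁ := zeta24 ^ (n * q))
    (m₂ := zeta24 ^ (n * p)) (m₃ := zeta24 ^ n) (m₄ := zeta24 ^ (n * (p * q)))
    (x₁ := ModularForm.eta (x / p)) (x₂ := ModularForm.eta (x / q))
    (x₃ := ModularForm.eta (x / (p * q))) (x₄ := ModularForm.eta x) ?_ rfl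
    (mul_ne_zero (zpow_ne_zero _ zeta24_ne_zero) (zpow_ne_zero _ zeta24_ne_zero)) (by simp)
  · simpa only [mul_one] using h
  · simp only [← zpow_add₀ zeta24_ne_zero]
    congr 1
    ring

/-- The shift by `n p q` multiplies the `e`-th power by `χ ^ n` and the prefactor by `χ ^ (-n p q)`;
these cancel because `p q ≡ 1` modulo `δ`. This allows arbitrary representatives `μ` in `compS_C'`.
-/
lemma A'_add_mul (hp : 0 < p) {q : ℕ} (hq : 0 < q) (h : e ∣ s p q)
    (hN : p * q ≡ 1 [MOD delta p q e]) (ν n : ℤ) :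
    A' p q e (ν + n * (p * q)) = A' p q e ν := by
  funext z
  have e1 : (z : ℂ) + (ν + n * (p * q) : ℤ) = (z + ν) + (n * (p * q) : ℤ) := by
    push_cast; ring
  rw [A', A', A, A, e1, w_add_mul hp hq, mul_pow, phi_zpow_pow, ← mul_assoc,
    ← zpow_add₀ (chi_ne_zero p q e)]
  congr 1
  apply chi_zpow_congr hp hq h
  obtain ⟨m, hm⟩ := delta_dvd_mul_sub_one hN
  exact ⟨-n * m, by linear_combination -n * hm⟩

lemma mu_eq [hp : Fact p.Prime] {ν μ k : ℤ} (h0 : 0 ≤ μ) (hlt : μ < p)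
    (hdet : 1 = -μ * ν + k * p) : mu p 1 ν = μ := by
  have h1 : (1 : ZMod p) = -μ * ν := by
    have := congrArg (Int.cast : ℤ → ZMod p) hdet
    push_cast at this
    simpa using this
  have hν : (ν : ZMod p) ≠ 0 := by
    intro h
    simp [h] at h1
  have h2 : (-((1 * ν : ℤ) : ZMod p)⁻¹) = (μ : ZMod p) := by
    rw [one_mul, inv_eq_of_mul_eq_one_left (b := (ν : ZMod p)) (a := -(μ : ZMod p)) h1.symm, neg_neg]
  rw [mu, h2]
  have h3 := ZMod.val_intCast (n := p) μ
  rw [h3, Int.emod_eq_of_lt h0 hlt]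

/-- The factor `8` comes from `p` odd, and the factor `3` from `p² - 1` unless `p = 3`. In that case
`s = 6` and `3 ∤ δ`, so `3 ∣ e`. -/
lemma dvd_mul_sq_sub_one [hp : Fact p.Prime] (hpo : Odd p) (h : e ∣ s p p)
    (hN : p * p ≡ 1 [MOD delta p p e]) : (24 : ℤ) ∣ e * ((p : ℤ) ^ 2 - 1) := by
  have h8 : (8 : ℤ) ∣ (p : ℤ) ^ 2 - 1 := by
    have : Odd (p : ℤ) := by exact_mod_cast hpo
    exact Int.eight_dvd_sq_sub_one_of_odd this
  have h3 : (3 : ℤ) ∣ e * ((p : ℤ) ^ 2 - 1) := by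
    rcases eq_or_ne p 3 with rfl | hp3
    · have hd := delta_mul h
      have hs : s 3 3 = 6 := by decide
      rw [hs] at hd
      have h3d : ¬ 3 ∣ delta 3 3 e := fun h3 ↦ by
        have := (mod_three_of_three_dvd_delta h hN h3).1
        lia
      have : 3 ∣ e := by
        refine (Nat.Coprime.dvd_of_dvd_mul_left ?_ (⟨2, hd⟩ : 3 ∣ delta 3 3 e * e))
        exact (Nat.prime_three.coprime_iff_not_dvd).mpr h3d
      exact (by exact_mod_cast this : (3 : ℤ) ∣ e).mul_right _
    · refine Dvd.dvd.mul_left ?_ _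
      have h3p : ¬ 3 ∣ p := fun h ↦
        hp3 ((Nat.prime_dvd_prime_iff_eq Nat.prime_three hp.out).mp h).symm
      obtain ⟨m, hm⟩ : ∃ m : ℤ, (p : ℤ) = 3 * m + 1 ∨ (p : ℤ) = 3 * m + 2 := ⟨p / 3, by lia⟩
      rcases hm with hm | hm
      · exact ⟨3 * m ^ 2 + 2 * m, by rw [hm]; ring⟩
      · exact ⟨3 * m ^ 2 + 4 * m + 1, by rw [hm]; ring⟩
  exact IsCoprime.mul_dvd (by norm_num : IsCoprime (3 : ℤ) 8) h3 (h8.mul_left _)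

lemma zeta24_zpow_mul_eq {p e : ℕ} (hp : 0 < p) {a b x y : ℤ}
    (h : (24 : ℤ) ∣ e * ((x - y) - ((p : ℤ) - 1) ^ 2 * (a - b))) :
    chi p p e ^ a * (zeta24 ^ x) ^ e = chi p p e ^ b * (zeta24 ^ y) ^ e := by
  rw [chi_zpow hp hp, chi_zpow hp hp, ← zpow_natCast, ← zpow_natCast, ← zpow_mul, ← zpow_mul,
    ← zpow_add₀ zeta24_ne_zero, ← zpow_add₀ zeta24_ne_zero]
  apply zeta24_zpow_congr
  convert! h using 1
  ring

lemma C_apply [Fact p.Prime] (ν : ℤ) (z : ℍ) : C p ν z = eps p ν * zeta24 ^ theta p ν *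
    (Real.sqrt p * (ModularForm.eta (p * z) ^ 2 /
      (ModularForm.eta z * ModularForm.eta (z + ν / p)))) := by
  rw [C]
  ring

lemma theta_eq [Fact p.Prime] (hpo : Odd p) {ν μ k : ℤ} (h0 : 0 ≤ μ) (hlt : μ < p)
    (hdet : 1 = -μ * ν + k * p) :
    theta p ν = p * ν * (1 - μ ^ 2) + (-3 * p + 2 + k) * μ - 3 + 3 * p := by
  have hp2 : p ≠ 2 := by rintro rfl; exact absurd hpo (by decide)
  have hp0 : (p : ℤ) ≠ 0 := by exact_mod_cast hpo.pos.ne'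
  rw [theta, if_neg hp2, mu_eq h0 hlt hdet, show 1 + μ * ν = k * p by linarith,
    Int.mul_ediv_cancel _ hp0]

lemma eps_eq [Fact p.Prime] (hpo : Odd p) (ν : ℤ) : eps p ν = J(-ν | p) := by
  have hp2 : p ≠ 2 := by rintro rfl; exact absurd hpo (by decide)
  rw [eps, if_neg hp2, jacobiSym.legendreSym.to_jacobiSym]

lemma delta_two_two (h : e ∣ s 2 2) (hne : e ≠ s 2 2) (hN : 2 * 2 ≡ 1 [MOD delta 2 2 e]) :
    delta 2 2 e = 3 ∧ e = 8 := by
  have hd := delta_eq_three_of_even h hne hN (by decide)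
  have hs : s 2 2 = 24 := by decide
  have := delta_mul h
  rw [hd, hs] at this
  exact ⟨hd, by lia⟩

lemma alpha0_three : alpha0 3 = 0 := by decide

theorem compS_A'_self [hp : Fact p.Prime] (h : e ∣ s p p) (hne : e ≠ s p p)
    (hN : p * p ≡ 1 [MOD delta p p e]) {ρ ϖ k : ℤ} (hρ : 1 ≤ ρ) (hρp : ρ < p) (hϖ : 1 ≤ ϖ)
    (hϖp : ϖ < p) (hdet : 1 = -ϖ * ρ + k * p) :
    compS (A' p p e (ρ * p)) = chi p p e ^ alpha0 (delta p p e) • C' p e ϖ := by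
  have hdet' : 1 = -ρ * ϖ + k * p := by linarith
  have hmu := mu_eq (by linarith) hρp hdet'
  rw [compS_eq_smul_iff]
  intro z
  rw [A', A, C', C_apply, coe_S_smul, hmu]
  rcases hp.out.eq_two_or_odd' with rfl | hpo
  · obtain ⟨hd, -⟩ := delta_two_two h hne hN
    obtain rfl : ρ = 1 := by push_cast at hρp; linarith
    obtain rfl : ϖ = 1 := by push_cast at hϖp; linarith
    obtain rfl : k = 1 := by push_cast at hdet; linarith
    -- For `p = 2` all parameters equal `1` and the multiplier is trivial; the exponents `-2` and
    -- `1` of `χ` agree modulo `δ = 3`.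
    have hm : zeta24 ^ (2 * 1 : ℤ) =
        1 * (zeta24 ^ (1 * ((2 : ℕ) : ℤ)) * multRight 2 1 1 1) := by
      rw [multRight]
      norm_num
    rw [w_self_neg_one_div_add two_pos z.im_pos
      (isMultiplier_multRight two_pos odd_one (by norm_num)) hm, hd, alpha0_three, eps, theta,
      if_pos rfl, if_pos rfl]
    have hc : chi 2 2 e ^ (0 - 1 * ((2 : ℕ) : ℤ) : ℤ) = chi 2 2 e ^ (1 : ℤ) :=
      chi_zpow_congr two_pos two_pos h (by rw [hd]; norm_num)
    rw [hc]
    simp only [zpow_zero, Int.cast_one, one_mul]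
  · set j := J(-ϖ | p) with hj
    have hj2 : (j : ℂ) * j = 1 := by
      have : j * j = 1 := jacobiSym_two_self ⟨ρ, k, by linarith⟩
      exact_mod_cast this
    have hm : zeta24 ^ (2 * ρ) = (j * zeta24 ^ (2 * ρ - ρ * p -
        ((ρ - ϖ) * p - k * ϖ * ((p : ℤ) ^ 2 - 1) - 3 * p + 3))) *
          (zeta24 ^ (ρ * p) * multOdd p ρ k ϖ) := by
      rw [multOdd, ← hj]
      generalize hx : (ρ - ϖ) * p - k * ϖ * ((p : ℤ) ^ 2 - 1) - 3 * p + 3 = x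
      have : zeta24 ^ (2 * ρ) = zeta24 ^ (2 * ρ - ρ * p - x) * (zeta24 ^ (ρ * p) * zeta24 ^ x) := by
        simp only [← zpow_add₀ zeta24_ne_zero]
        congr 1
        ring
      rw [this]
      linear_combination (-(zeta24 ^ (2 * ρ - ρ * p - x) * (zeta24 ^ (ρ * p) * zeta24 ^ x))) * hj2
    rw [w_self_neg_one_div_add hp.out.pos z.im_pos (isMultiplier_multOdd hpo hdet) hm,
      eps_eq hpo, theta_eq hpo (by linarith) hρp hdet', ← hj, mul_pow, mul_pow, mul_pow (j * _ : ℂ),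
      mul_pow (j : ℂ)]
    have key : chi p p e ^ (alpha0 (delta p p e) - ρ * p) * (zeta24 ^ (2 * ρ - ρ * p -
        ((ρ - ϖ) * p - k * ϖ * ((p : ℤ) ^ 2 - 1) - 3 * p + 3))) ^ e =
        chi p p e ^ (alpha0 (delta p p e) + ρ) *
          (zeta24 ^ (p * ϖ * (1 - ρ ^ 2) + (-3 * p + 2 + k) * ρ - 3 + 3 * p)) ^ e := by
      apply zeta24_zpow_mul_eq hp.out.pos
      obtain ⟨l, hl⟩ := dvd_mul_sq_sub_one hpo h hN
      -- By the determinant relation the exponents differ by a multiple of `e (p² - 1) = 24 l`.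
      refine ⟨l * ((p - 1) * ρ + k * (ϖ + ρ)), ?_⟩
      linear_combination ((p - 1) * ρ + k * (ϖ + ρ)) * hl + e * p * ρ * hdet
    rw [zpow_add₀ (chi_ne_zero p p e) (alpha0 (delta p p e)) ρ] at key
    linear_combination (j : ℂ) ^ e * (Real.sqrt p * (ModularForm.eta (p * z) ^ 2 /
      (ModularForm.eta z * ModularForm.eta (z + ϖ / p)))) ^ e * key

lemma compS_C'_of_lt [hp : Fact p.Prime] (h : e ∣ s p p) (hne : e ≠ s p p)
    (hN : p * p ≡ 1 [MOD delta p p e]) {ν μ k : ℤ} (hν : 1 ≤ ν) (hνp : ν < p) (hμ : 0 ≤ μ)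
    (hμp : μ < p) (hdet : 1 = -μ * ν + k * p) :
    compS (C' p e ν) = chi p p e ^ alpha0 (delta p p e) • A' p p e (μ * p) := by
  have hmu := mu_eq hμ hμp hdet
  rw [compS_eq_smul_iff]
  intro z
  rw [A', A, C', C_apply, coe_S_smul, hmu]
  rcases hp.out.eq_two_or_odd' with rfl | hpo
  · obtain ⟨hd, -⟩ := delta_two_two h hne hN
    obtain rfl : ν = 1 := by push_cast at hνp; linarith
    obtain rfl : μ = 1 := by push_cast at hμp; lia
    obtain rfl : k = 1 := by push_cast at hdet; linarith
    have hm : zeta24 ^ (-2 * 1 : ℤ) =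
        1 * (zeta24 ^ (-1 * ((2 : ℕ) : ℤ)) * multRight 2 1 1 1) := by
      rw [multRight]
      norm_num
    rw [sqrt_mul_eta_quotient_neg_one_div two_pos z.im_pos
      (isMultiplier_multRight two_pos odd_one (by norm_num)) hm, hd, alpha0_three, eps, theta,
      if_pos rfl, if_pos rfl]
    have hc : chi 2 2 e ^ (1 : ℤ) = chi 2 2 e ^ (0 - 1 * ((2 : ℕ) : ℤ) : ℤ) :=
      chi_zpow_congr two_pos two_pos h (by rw [hd]; norm_num)
    simp only [zpow_zero, Int.cast_one, one_mul, hc]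
  · set j := J(-μ | p) with hj
    obtain ⟨m, hpm⟩ := id hpo
    have hj2 : (j : ℂ) * j = 1 := by
      have : j * j = 1 := jacobiSym_two_self ⟨ν, k, by linarith⟩
      exact_mod_cast this
    -- The symbols of `C` and of the multiplier combine to that of `-1`, since `μ ν ≡ -1` modulo
    -- `p`. The sign `(-1) ^ m` is written as a power of `ζ₂₄` to join the exponents.
    have hjν : (J(-ν | p) : ℂ) * j = zeta24 ^ (12 * (m : ℤ)) := by
      have h1 : J(-ν | p) * j = (-1) ^ m := by
        rw [hj, ← jacobiSym.mul_left]
        have h2 : J(-ν * -μ | p) = J(-1 | p) := jacobiSym.mod_left'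
          (Int.ModEq.symm (Int.modEq_iff_dvd.mpr ⟨k, by linarith⟩))
        rw [h2, jacobiSym.at_neg_one hpo, ZMod.χ₄_eq_neg_one_pow (Nat.odd_iff.mp hpo),
          show p / 2 = m by lia]
      rw [← neg_one_pow_eq_zeta24_zpow]
      exact_mod_cast h1
    have hm : zeta24 ^ (-2 * μ) = (j * zeta24 ^ (-2 * μ + μ * p -
        ((ν - μ) * p - k * μ * ((p : ℤ) ^ 2 - 1) - 3 * p + 3))) *
          (zeta24 ^ (-μ * p) * multOdd p ν k μ) := by
      rw [multOdd, ← hj]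
      generalize hx : (ν - μ) * p - k * μ * ((p : ℤ) ^ 2 - 1) - 3 * p + 3 = x
      have : zeta24 ^ (-2 * μ) =
          zeta24 ^ (-2 * μ + μ * p - x) * (zeta24 ^ (-μ * p) * zeta24 ^ x) := by
        simp only [← zpow_add₀ zeta24_ne_zero]
        congr 1
        ring
      rw [this]
      linear_combination (-(zeta24 ^ (-2 * μ + μ * p - x) *
        (zeta24 ^ (-μ * p) * zeta24 ^ x))) * hj2
    have hw := sqrt_mul_eta_quotient_neg_one_div hp.out.pos z.im_pos
      (isMultiplier_multOdd hpo hdet) hm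
    rw [hw, eps_eq hpo, theta_eq hpo hμ hμp hdet]
    generalize hx : -2 * μ + μ * p - ((ν - μ) * p - k * μ * ((p : ℤ) ^ 2 - 1) - 3 * p + 3) = x
    generalize hy : p * ν * (1 - μ ^ 2) + (-3 * p + 2 + k) * μ - 3 + 3 * p = y
    have hprod : (J(-ν | p) : ℂ) * zeta24 ^ y * (j * zeta24 ^ x * w p p (z + (μ * p : ℤ))) =
        zeta24 ^ (12 * (m : ℤ) + y + x) * w p p (z + (μ * p : ℤ)) := by
      rw [zpow_add₀ zeta24_ne_zero, zpow_add₀ zeta24_ne_zero, ← hjν]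
      ring
    have key : chi p p e ^ μ * (zeta24 ^ (12 * (m : ℤ) + y + x)) ^ e =
        chi p p e ^ (alpha0 (delta p p e) + (alpha0 (delta p p e) - μ * p)) *
          (zeta24 ^ (0 : ℤ)) ^ e := by
      have h0 : chi p p e ^ (alpha0 (delta p p e) + (alpha0 (delta p p e) - μ * p)) =
          chi p p e ^ (-μ * p) := by
        apply chi_zpow_congr hp.out.pos hp.out.pos h
        convert! (delta_dvd_alpha0 h hne hN).1 using 1
        ring
      rw [h0]
      apply zeta24_zpow_mul_eq hp.out.pos
      obtain ⟨l, hl⟩ := dvd_mul_sq_sub_one hpo h hN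
      have hpm' : (p : ℤ) = 2 * m + 1 := by exact_mod_cast hpm
      -- The two constants `3p - 3` in `x` and `y` add up to `12 m`, which with the sign `12 m`
      -- gives `24 m`.
      refine ⟨-l * (p - 1) * μ + e * m, ?_⟩
      rw [← hx, ← hy]
      linear_combination (-(p - 1) * μ) * hl + 6 * e * hpm' - e * μ * p * hdet
    rw [hprod, mul_pow, ← mul_assoc, key, zpow_zero, one_pow, mul_one, zpow_add₀ (chi_ne_zero p p e),
      mul_assoc]

theorem compS_C' [hp : Fact p.Prime] (h : e ∣ s p p) (hne : e ≠ s p p)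
    (hN : p * p ≡ 1 [MOD delta p p e]) {ν μ : ℤ} (hν : 1 ≤ ν) (hνp : ν < p)
    (hμ : μ * ν ≡ -1 [ZMOD p]) :
    compS (C' p e ν) = chi p p e ^ alpha0 (delta p p e) • A' p p e (μ * p) := by
  have hp0 : (0 : ℤ) < p := by exact_mod_cast hp.out.pos
  obtain ⟨k, hk⟩ := hμ.symm.dvd
  have hmod := Int.emod_add_mul_ediv μ p
  have hA := A'_add_mul hp.out.pos hp.out.pos h hN (μ % p * p) (μ / p)
  rw [show μ % p * p + μ / p * (p * p) = (μ % p + p * (μ / p)) * p by ring, hmod] at hA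
  rw [hA]
  refine compS_C'_of_lt (k := k - μ / p * ν) h hne hN hν hνp (Int.emod_nonneg _ hp0.ne')
    (Int.emod_lt_of_pos _ hp0) ?_
  linear_combination hk + ν * hmod

end SamePrime

end DoubleEta

/-! ### Assembly of the transformation formulas. -/

open DoubleEta in
theorem mainTheorem8 (p₁ p₂ : ℕ) [Fact p₁.Prime] [Fact p₂.Prime] (e : ℕ)
    (hes : e ∣ s p₁ p₂) (hne : e ≠ s p₁ p₂)
    (hN : p₁ * p₂ ≡ 1 [MOD delta p₁ p₂ e]) :
    (compS (B' p₁ p₂ e) = chi p₁ p₂ e ^ alpha0 (delta p₁ p₂ e) • A' p₁ p₂ e 0 ∧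
      compS (A' p₁ p₂ e 0) = chi p₁ p₂ e ^ alpha0 (delta p₁ p₂ e) • B' p₁ p₂ e) ∧
    (∀ ν ω v₁₂ : ℤ, 0 < ν → ν < p₁ * p₂ → Int.gcd ν (p₁ * p₂) = 1 →
      1 = -ω * ν + v₁₂ * (p₁ * p₂) →
      compS (A' p₁ p₂ e ν) =
        chi p₁ p₂ e ^ alpha0 (delta p₁ p₂ e) • A' p₁ p₂ e ω) ∧
    (p₁ ≠ p₂ → ∀ u v : ℤ, u * p₁ + v * p₂ = 1 →
      (∀ ν ρ ϖ k : ℤ, ν = p₁ * ρ → 0 < ν → ν < p₁ * p₂ → 1 = -ϖ * ν + k * p₂ →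
        compS (A' p₁ p₂ e ν) =
          chi p₁ p₂ e ^ alpha0 (delta p₁ p₂ e) • C₂' p₁ p₂ u v e ϖ) ∧
      (∀ ν μ : ℤ, 1 ≤ ν → ν < p₂ → μ * (ν * p₁) ≡ -1 [ZMOD p₂] →
        compS (C₂' p₁ p₂ u v e ν) =
          chi p₁ p₂ e ^ alpha0 (delta p₁ p₂ e) • A' p₁ p₂ e (μ * p₁)) ∧
      compS (C₂' p₁ p₂ u v e 0) =
        chi p₁ p₂ e ^ alpha0 (delta p₁ p₂ e) • C₁' p₁ p₂ u v e 0) ∧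
    (p₁ = p₂ →
      (∀ ν ρ ϖ k : ℤ, ν = ρ * p₁ → 1 ≤ ρ → ρ < p₁ → 1 ≤ ϖ → ϖ < p₁ →
        1 = -ϖ * ρ + k * p₁ →
        compS (A' p₁ p₂ e ν) =
          chi p₁ p₂ e ^ alpha0 (delta p₁ p₂ e) • C' p₁ e ϖ) ∧
      (∀ ν μ : ℤ, 1 ≤ ν → ν < p₁ → μ * ν ≡ -1 [ZMOD p₁] →
        compS (C' p₁ e ν) =
          chi p₁ p₂ e ^ alpha0 (delta p₁ p₂ e) • A' p₁ p₂ e (μ * p₁))) := by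
  have hp : 0 < p₁ := (Fact.out : p₁.Prime).pos
  have hq : 0 < p₂ := (Fact.out : p₂.Prime).pos
  refine ⟨⟨compS_B' hp hq hes hne hN, compS_A'_zero hp hq⟩,
    fun ν ω v₁₂ _ _ _ hdet ↦ compS_A'_of_coprime hp hq hes hne hN hdet,
    fun hpq u v _ ↦ ⟨?_, ?_, compS_C₂'_zero hpq hes hne hN u v⟩, ?_⟩
  · rintro ν ρ ϖ k rfl _ _ hdet
    exact compS_A'_mul hpq hes hne hN u v hdet
  · intro ν μ _ _ hμ
    obtain ⟨k, hk⟩ := hμ.symm.dvd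
    exact compS_C₂' (k := k) hpq hes hne hN u v (by linarith)
  · rintro rfl
    refine ⟨?_, fun ν μ hν hνp hμ ↦ compS_C' hes hne hN hν hνp hμ⟩
    rintro ν ρ ϖ k rfl hρ hρp hϖ hϖp hdet
    exact compS_A'_self hes hne hN hρ hρp hϖ hϖp hdet
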